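/- Setting. There are $K$ arms and $T$ rounds. In round $t\in\{1,\dots,T\}$ arm $a$ has a true reward $X_t(a)\in[0,1]$ with mean $\mu_t(a)$; the rewards of a round are independent of everything that happened in earlier rounds. Put $\mu_t^*=\max_a\mu_t(a)$, and call arm $a$ suboptimal in round $t$ if $\mu_t(a)<\mu_t^*$. The number of breakpoints $\beta_T$ is the number of $t\in\{1,\dots,T-1\}$ such that the distribution of $X_t(a)$ differs from that of $X_{t+1}(a)$ for at least one arm $a$; assume $\beta_T\ge 1$. The drift functions $f_1,\dots,f_T$ are non-decreasing and Lipschitz on $[0,\infty)$ with constant $l$, and $f_t(0)=0$. Scheme. Let $a_s$ be the arm pulled and $r_s$ the reward received in round $s$. For a discount factor $\gamma\in(0,1)$ put $$N_t(\gamma,a)=\sum_{s=1}^t\gamma^{t-s}\mathbf 1(a_s=a),\quad n_t(\gamma)=\sum_{a}N_t(\gamma,a),\quad \bar X_t(\gamma,a)=\frac1{N_t(\gamma,a)}\sum_{s=1}^t\gamma^{t-s}\mathbf 1(a_s=a)\,r_s,\quad c_t(\gamma,a)=2\sqrt{\frac{\xi\log n_t(\gamma)}{N_t(\gamma,a)}},$$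 with $\bar X_t(\gamma,a)=0$ if $a$ has not been pulled in rounds $1,\dots,t$. In round $t\le K$ the arm $a_t=t$ is pulled; in round $t>K$ an arm $a_t$ that maximizes $\bar X_{t-1}(\gamma,a)+c_{t-1}(\gamma,a)$ over $a$ is pulled (Discounted UCB recommendation). Let $g_t$ be a maximizer of $\bar X_{t-1}(\gamma,\cdot)$ (the greedy arm). If $a_t=g_t$, then $r_t=X_t(a_t)$. If $a_t\ne g_t$, the compensation $\chi_t=\bar X_{t-1}(\gamma,g_t)-\bar X_{t-1}(\gamma,a_t)$ is paid and $r_t=X_t(a_t)+f_t(\chi_t)$. Ties may be broken in any way that does not depend on the current or future rewards. Theorem. Let $K\ge1$, $\xi>1/2$, $l\ge0$, $\Delta>0$ and $\eta>0$. There is a constant $\tilde\eta>0$, depending only on $K,\xi,l,\Delta,\eta$, such that in every such environment, for every horizon $T$, if the scheme is run with $\gamma=1-\eta\sqrt{\beta_T/T}$ and this $\gamma$ is positive, then: 1. for every arm $a$ with $\mu_t^*-\mu_t(a)\ge\Delta$ in all rounds $t\le T$ in which $a$ is suboptimal, the number $N_T(a)$ of rounds $t\le T$ in which $a$ is pulled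 while suboptimal satisfies $$\mathbb E[N_T(a)]\le\tilde\eta\,\sqrt{T\beta_T}\,\log T;$$ 2. if all arms have this property, the expected regret satisfies $$\mathbb E\Big[\sum_{t=1}^T\big(\mu_t^*-X_t(a_t)\big)\Big]\le K\,\tilde\eta\,\sqrt{T\beta_T}\,\log T.$$ -/

import Mathlib

open MeasureTheory ProbabilityTheory

noncomputable section

namespace IncentivizedBandit

/-! Rounds are numbered `1, 2, …, T`; the arms are the elements of `Fin K`. -/

/-! ### Discounted statistics along one trajectory

`A s` is the arm pulled and `r s` the reward received (drift included) in round `s`. -/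

/-- Discounted number of pulls of arm `a` in rounds `1, …, t`. -/
def discCount {K : ℕ} (γ : ℝ) (A : ℕ → Fin K) (t : ℕ) (a : Fin K) : ℝ :=
  ∑ s ∈ Finset.Icc 1 t, if A s = a then γ ^ (t - s) else 0

/-- Sum of the discounted numbers of pulls of all arms in rounds `1, …, t`. -/
def discTotal {K : ℕ} (γ : ℝ) (A : ℕ → Fin K) (t : ℕ) : ℝ :=
  ∑ a, discCount γ A t a

/-- Discounted average of the rewards received from arm `a` in rounds `1, …, t`
(equal to `0` if `a` has not been pulled yet). -/
def discMean {K : ℕ} (γ : ℝ) (A : ℕ → Fin K) (r : ℕ → ℝ) (t : ℕ) (a : Fin K) : ℝ :=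
  (∑ s ∈ Finset.Icc 1 t, if A s = a then γ ^ (t - s) * r s else 0) / discCount γ A t a

/-- Discounted confidence radius of arm `a` after `t` rounds. -/
def confRadius {K : ℕ} (γ ξ : ℝ) (A : ℕ → Fin K) (t : ℕ) (a : Fin K) : ℝ :=
  2 * √(ξ * Real.log (discTotal γ A t) / discCount γ A t a)

/-- Upper confidence bound of arm `a` after `t` rounds. -/
def ucb {K : ℕ} (γ ξ : ℝ) (A : ℕ → Fin K) (r : ℕ → ℝ) (t : ℕ) (a : Fin K) : ℝ :=
  discMean γ A r t a + confRadius γ ξ A t a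

/-- `A, g, χ, r` (arms pulled, greedy arms, compensations, rewards received) form a trajectory over
`T` rounds of the incentivized scheme with Discounted UCB as recommender, for the drift functions
`f` and the true rewards `x`. The choice made in round `t + 1` uses the data of rounds `1, …, t`;
ties in either maximization may be broken in any way. -/
structure IsIncentivizedDUCB {K : ℕ} (T : ℕ) (γ ξ : ℝ) (f : ℕ → ℝ → ℝ) (x : ℕ → Fin K → ℝ)
    (A g : ℕ → Fin K) (χ r : ℕ → ℝ) : Prop where
  /-- each arm is pulled once in the first `K` rounds, in order -/
  init : ∀ t < T, t < K → (A (t + 1) : ℕ) = t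
  /-- afterwards the recommended (and pulled) arm maximizes the upper confidence bound -/
  recommend : ∀ t < T, K ≤ t → ∀ b, ucb γ ξ A r t b ≤ ucb γ ξ A r t (A (t + 1))
  /-- the greedy arm maximizes the empirical average -/
  greedy : ∀ t < T, ∀ b, discMean γ A r t b ≤ discMean γ A r t (g (t + 1))
  /-- compensation offered -/
  compensation : ∀ t < T, χ (t + 1) =
    if A (t + 1) = g (t + 1) then 0
    else discMean γ A r t (g (t + 1)) - discMean γ A r t (A (t + 1))
  /-- reward received: the true reward, plus the drift if a compensation is offered -/
  reward : ∀ t < T, r (t + 1) =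
    if A (t + 1) = g (t + 1) then x (t + 1) (A (t + 1))
    else x (t + 1) (A (t + 1)) + f (t + 1) (χ (t + 1))

/-- The drift functions of rounds `1, …, T` are non-decreasing, vanish at `0` and are Lipschitz with
constants at most `l` (as functions of a compensation, which is non-negative). -/
def IsDrift (T : ℕ) (l : NNReal) (f : ℕ → ℝ → ℝ) : Prop :=
  ∀ t ∈ Finset.Icc 1 T, f t 0 = 0 ∧ MonotoneOn (f t) (Set.Ici 0) ∧
    LipschitzOnWith l (f t) (Set.Ici 0)

/-! ### The stochastic environment -/

/-- `X t a` is the true reward of arm `a` in round `t`. Rewards lie in `[0, 1]`, and the rewards of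
a round are independent of the information `ℱ t` available after the preceding `t` rounds (which
contains all earlier rewards, and possibly independent randomness used to break ties). -/
structure IsRewardProcess {Ω : Type*} [mΩ : MeasurableSpace Ω] {K : ℕ} (T : ℕ) (P : Measure Ω)
    (ℱ : Filtration ℕ mΩ) (X : ℕ → Fin K → Ω → ℝ) : Prop where
  measurable : ∀ t ∈ Finset.Icc 1 T, ∀ a, Measurable[ℱ t] (X t a)
  mem_unit : ∀ t ∈ Finset.Icc 1 T, ∀ a, ∀ᵐ ω ∂P, X t a ω ∈ Set.Icc (0 : ℝ) 1
  indep : ∀ t < T, Indep (⨆ a, MeasurableSpace.comap (X (t + 1) a) inferInstance) (ℱ t) P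

section Quantities

variable {Ω : Type*} [MeasurableSpace Ω] {K : ℕ}

open Classical in
/-- Number of breakpoints within the horizon `T`: the number of rounds `t` with `1 ≤ t < T` after
which the reward distribution of at least one arm changes. -/
def numBreakpoints (T : ℕ) (P : Measure Ω) (X : ℕ → Fin K → Ω → ℝ) : ℕ :=
  ((Finset.Ico 1 T).filter fun t => ∃ a, P.map (X t a) ≠ P.map (X (t + 1) a)).card

/-- Expected reward of arm `a` in round `t`. -/
def meanReward (P : Measure Ω) (X : ℕ → Fin K → Ω → ℝ) (t : ℕ) (a : Fin K) : ℝ :=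
  ∫ ω, X t a ω ∂P

/-- Largest expected reward in round `t`. -/
def bestReward (P : Measure Ω) (X : ℕ → Fin K → Ω → ℝ) (t : ℕ) : ℝ :=
  ⨆ a, meanReward P X t a

/-- In every round of the horizon in which arm `a` is suboptimal, it is so by at least `Δ`. -/
def GapAtLeast (T : ℕ) (P : Measure Ω) (X : ℕ → Fin K → Ω → ℝ) (Δ : ℝ) (a : Fin K) : Prop :=
  ∀ t ∈ Finset.Icc 1 T, meanReward P X t a < bestReward P X t →
    Δ ≤ bestReward P X t - meanReward P X t a

open Classical in
/-- Number of rounds up to `T` in which arm `a` is pulled while it is suboptimal. -/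
def suboptimalPulls (T : ℕ) (P : Measure Ω) (X : ℕ → Fin K → Ω → ℝ) (A : ℕ → Ω → Fin K)
    (a : Fin K) (ω : Ω) : ℝ :=
  ∑ t ∈ Finset.Icc 1 T,
    if A t ω = a ∧ meanReward P X t a < bestReward P X t then 1 else 0

/-- Regret over the horizon `T`, measured with the true (drift-free) rewards. -/
def regret (T : ℕ) (P : Measure Ω) (X : ℕ → Fin K → Ω → ℝ) (A : ℕ → Ω → Fin K) (ω : Ω) : ℝ :=
  ∑ t ∈ Finset.Icc 1 T, (bestReward P X t - X t (A t ω) ω)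

end Quantities

end IncentivizedBandit

end

namespace IncentivizedBandit

noncomputable section

/-! ### Discounted sums -/

/-! Write Λ = log (1 / (1 - γ)). A suboptimal pull of arm a in round t + 1 falls into one of four
classes: t is less than K + D with D = `memoryLength γ`, t follows a breakpoint by less than D
rounds, the discounted count of a is below a multiple of Λ, or the noise of a or of the best arm
deviates. Outside these classes the discounted averages have forgotten earlier laws up to a small
bias, so `le_ucb` and `ucb_lt` give μ* ≤ UCB(best) ≤ UCB(a) < μ(a) + Δ ≤ μ*, a contradiction.
`integral_suboptimalPulls_le` adds up the four classes; for 1 - γ = η √(β/T) each total is O(√(Tβ)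
log T). A suboptimal pull costs at most 1 in expected regret.

The difficulty is the drift, which feeds back: inflated averages cause larger compensations, which
cause larger drifts. Being non-negative, it does no harm to the lower estimate of the best arm. For
the upper estimate, the recommended arm beats the greedy one in UCB, so the compensation is at most
its confidence radius. Such drifts are O(√(Λ/N)) at count N and sum to O(√(ΛN)), the order of the
noise (`dsum_inv_sqrt_le`). This is useless for a long neglected arm, whose radius is huge; pulls at
counts below 1/2 have discounted number at most 3/2, but each needs an a priori bound.

That bound is `drift_le`: every drift is O(Λ). Strong induction: in a recent window of bounded
length some pulled arm has a large count (`exists_pull_of_large_discCount`). There the inductive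
bound R on its few uncontrolled drifts is diluted to a small fraction of R, and since this arm
maximizes the UCB, all averages are bounded. Until the current round they grow by at most (1 + l)^K
(`mean_le_of_window`), which the dilution absorbs.

The noise is handled by Hoeffding's exponential supermartingale, with dyadic peeling over the random
count (`measureReal_abs_discNoise_gt_le`). -/

/-- Discounted sum of the weights `w 1, …, w t`. -/
def dsum (γ : ℝ) (w : ℕ → ℝ) (t : ℕ) : ℝ :=
  ∑ s ∈ Finset.Icc 1 t, γ ^ (t - s) * w s

lemma dsum_zero (γ : ℝ) (w : ℕ → ℝ) : dsum γ w 0 = 0 := by simp [dsum]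

lemma dsum_succ (γ : ℝ) (w : ℕ → ℝ) (t : ℕ) :
    dsum γ w (t + 1) = γ * dsum γ w t + w (t + 1) := by
  unfold dsum
  rw [Finset.sum_Icc_succ_top (by omega), Finset.mul_sum]
  congr 1
  · refine Finset.sum_congr rfl fun s hs => ?_
    rw [Finset.mem_Icc] at hs
    rw [show t + 1 - s = (t - s) + 1 by omega, pow_succ]
    ring
  · simp

lemma dsum_mono {γ : ℝ} (hγ : 0 ≤ γ) {v w : ℕ → ℝ} {t : ℕ}
    (h : ∀ s ∈ Finset.Icc 1 t, v s ≤ w s) : dsum γ v t ≤ dsum γ w t :=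
  Finset.sum_le_sum fun s hs => mul_le_mul_of_nonneg_left (h s hs) (pow_nonneg hγ _)

lemma dsum_nonneg {γ : ℝ} (hγ : 0 ≤ γ) {w : ℕ → ℝ} {t : ℕ}
    (h : ∀ s ∈ Finset.Icc 1 t, 0 ≤ w s) : 0 ≤ dsum γ w t :=
  Finset.sum_nonneg fun s hs => mul_nonneg (pow_nonneg hγ _) (h s hs)

lemma dsum_add (γ : ℝ) (v w : ℕ → ℝ) (t : ℕ) :
    dsum γ (fun s => v s + w s) t = dsum γ v t + dsum γ w t := by
  simp [dsum, mul_add, Finset.sum_add_distrib]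

lemma dsum_sub (γ : ℝ) (v w : ℕ → ℝ) (t : ℕ) :
    dsum γ (fun s => v s - w s) t = dsum γ v t - dsum γ w t := by
  simp [dsum, mul_sub, Finset.sum_sub_distrib]

lemma dsum_const_mul (γ c : ℝ) (w : ℕ → ℝ) (t : ℕ) :
    dsum γ (fun s => c * w s) t = c * dsum γ w t := by
  unfold dsum
  rw [Finset.mul_sum]
  exact Finset.sum_congr rfl fun s _ => by ring

lemma dsum_congr {γ : ℝ} {v w : ℕ → ℝ} {t : ℕ} (h : ∀ s ∈ Finset.Icc 1 t, v s = w s) :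
    dsum γ v t = dsum γ w t :=
  Finset.sum_congr rfl fun s hs => by rw [h s hs]

lemma dsum_one (γ : ℝ) (t : ℕ) : (1 - γ) * dsum γ (fun _ => 1) t = 1 - γ ^ t := by
  induction t with
  | zero => simp [dsum_zero]
  | succ t ih => rw [dsum_succ, pow_succ]; linear_combination γ * ih

lemma dsum_le_inv {γ : ℝ} (hγ : 0 ≤ γ) (hγ1 : γ < 1) {w : ℕ → ℝ} {t : ℕ}
    (h : ∀ s ∈ Finset.Icc 1 t, w s ≤ 1) : dsum γ w t ≤ 1 / (1 - γ) := by
  have h1 : dsum γ w t ≤ dsum γ (fun _ => 1) t := dsum_mono hγ h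
  have h2 := dsum_one γ t
  have h3 : 0 ≤ γ ^ t := pow_nonneg hγ t
  rw [le_div_iff₀ (by linarith)]
  nlinarith

/-- The recursion for `dsum` telescopes. It turns a uniform bound b on discounted sums into the
bound b (1 + (1 - γ) T) on a plain count. -/
lemma sum_eq_dsum (γ : ℝ) (w : ℕ → ℝ) (T : ℕ) :
    ∑ t ∈ Finset.range T, w (t + 1)
      = dsum γ w T + (1 - γ) * ∑ t ∈ Finset.range T, dsum γ w t := by
  induction T with
  | zero => simp [dsum_zero]
  | succ T ih => rw [Finset.sum_range_succ, Finset.sum_range_succ, ih, dsum_succ]; ring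

/-- Splitting a discounted sum at a time in the past. -/
lemma dsum_add_time (γ : ℝ) (w : ℕ → ℝ) (t D : ℕ) :
    dsum γ w (t + D) = γ ^ D * dsum γ w t + dsum γ (fun s => w (t + s)) D := by
  induction D with
  | zero => simp [dsum_zero]
  | succ D ih =>
    rw [← add_assoc, dsum_succ, ih, dsum_succ, pow_succ, add_assoc]; ring

/-! ### Discounted counts and averages -/

section Statistics

variable {K : ℕ} {γ : ℝ} {A : ℕ → Fin K}

/-- Indicator of the pulls of arm `a`. -/
def pullInd (A : ℕ → Fin K) (a : Fin K) (s : ℕ) : ℝ := if A s = a then 1 else 0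

lemma pullInd_nonneg (A : ℕ → Fin K) (a : Fin K) (s : ℕ) : 0 ≤ pullInd A a s := by
  unfold pullInd; split_ifs <;> norm_num

lemma pullInd_le_one (A : ℕ → Fin K) (a : Fin K) (s : ℕ) : pullInd A a s ≤ 1 := by
  unfold pullInd; split_ifs <;> norm_num

lemma discCount_eq_dsum (γ : ℝ) (A : ℕ → Fin K) (t : ℕ) (a : Fin K) :
    discCount γ A t a = dsum γ (pullInd A a) t := by
  unfold discCount dsum pullInd
  exact Finset.sum_congr rfl fun s _ => by split_ifs <;> simp

lemma discMean_eq_dsum (γ : ℝ) (A : ℕ → Fin K) (r : ℕ → ℝ) (t : ℕ) (a : Fin K) :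
    discMean γ A r t a = dsum γ (fun s => pullInd A a s * r s) t / discCount γ A t a := by
  unfold discMean dsum pullInd
  congr 1
  exact Finset.sum_congr rfl fun s _ => by by_cases hs : A s = a <;> simp [hs]

lemma discTotal_eq_dsum (γ : ℝ) (A : ℕ → Fin K) (t : ℕ) :
    discTotal γ A t = dsum γ (fun _ => 1) t := by
  unfold discTotal
  simp_rw [discCount_eq_dsum]
  unfold dsum
  rw [Finset.sum_comm]
  refine Finset.sum_congr rfl fun s _ => ?_
  rw [← Finset.mul_sum]
  simp [pullInd]

lemma discCount_succ (γ : ℝ) (A : ℕ → Fin K) (t : ℕ) (a : Fin K) :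
    discCount γ A (t + 1) a = γ * discCount γ A t a + pullInd A a (t + 1) := by
  rw [discCount_eq_dsum, dsum_succ, ← discCount_eq_dsum]

lemma discCount_nonneg (hγ : 0 ≤ γ) (A : ℕ → Fin K) (t : ℕ) (a : Fin K) :
    0 ≤ discCount γ A t a := by
  rw [discCount_eq_dsum]; exact dsum_nonneg hγ fun s _ => pullInd_nonneg A a s

lemma discCount_le_inv (hγ : 0 ≤ γ) (hγ1 : γ < 1) (A : ℕ → Fin K) (t : ℕ) (a : Fin K) :
    discCount γ A t a ≤ 1 / (1 - γ) := by
  rw [discCount_eq_dsum]; exact dsum_le_inv hγ hγ1 fun s _ => pullInd_le_one A a s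

lemma pow_le_discCount (hγ : 0 ≤ γ) (A : ℕ → Fin K) {s t : ℕ} (hs : 1 ≤ s) (hst : s ≤ t)
    {a : Fin K} (ha : A s = a) : γ ^ (t - s) ≤ discCount γ A t a := by
  rw [discCount_eq_dsum]
  unfold dsum
  have := Finset.single_le_sum (f := fun s => γ ^ (t - s) * pullInd A a s)
    (s := Finset.Icc 1 t) (fun i _ => mul_nonneg (pow_nonneg hγ _) (pullInd_nonneg A a i))
    (Finset.mem_Icc.2 ⟨hs, hst⟩)
  simpa [pullInd, ha] using this

lemma exists_pull_of_discCount_pos {t : ℕ} {a : Fin K} (h : discCount γ A t a ≠ 0) :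
    ∃ s, 1 ≤ s ∧ s ≤ t ∧ A s = a := by
  by_contra! hc
  apply h
  unfold discCount
  refine Finset.sum_eq_zero fun s hs => ?_
  rw [Finset.mem_Icc] at hs
  simp [hc s hs.1 hs.2]

/-- Division by zero is harmless: for γ > 0 a zero count means that the arm was never pulled, so
both sides vanish. -/
lemma discMean_mul_discCount (hγ : 0 < γ) (A : ℕ → Fin K) (r : ℕ → ℝ) (t : ℕ) (a : Fin K) :
    discMean γ A r t a * discCount γ A t a = dsum γ (fun s => pullInd A a s * r s) t := by
  rw [discMean_eq_dsum]
  by_cases h : discCount γ A t a = 0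
  · have h0 : ∀ s ∈ Finset.Icc 1 t, pullInd A a s * r s = 0 := by
      intro s hs
      rw [Finset.mem_Icc] at hs
      have hne : A s ≠ a := fun ha => by
        have := pow_le_discCount hγ.le A hs.1 hs.2 ha
        have := pow_pos hγ (t - s)
        linarith
      simp [pullInd, hne]
    rw [h, dsum_congr h0]
    simp [dsum]
  · field_simp

lemma discMean_zero (γ : ℝ) (A : ℕ → Fin K) (r : ℕ → ℝ) (a : Fin K) :
    discMean γ A r 0 a = 0 := by
  rw [discMean_eq_dsum, dsum_zero, zero_div]

lemma discMean_succ_of_ne (hγ : 0 < γ) {r : ℕ → ℝ} {t : ℕ} {a : Fin K} (h : A (t + 1) ≠ a) :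
    discMean γ A r (t + 1) a = discMean γ A r t a := by
  rw [discMean_eq_dsum, discMean_eq_dsum, dsum_succ, discCount_succ]
  simp only [pullInd, h, if_false, zero_mul, add_zero]
  exact mul_div_mul_left _ _ hγ.ne'

lemma discMean_nonneg (hγ : 0 ≤ γ) {r : ℕ → ℝ} {t : ℕ} (hr : ∀ s ∈ Finset.Icc 1 t, 0 ≤ r s)
    (a : Fin K) : 0 ≤ discMean γ A r t a := by
  rw [discMean_eq_dsum]
  exact div_nonneg (dsum_nonneg hγ fun s hs => mul_nonneg (pullInd_nonneg A a s) (hr s hs))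
    (discCount_nonneg hγ A t a)

/-- At a pull the new average is a convex combination of the old average and the new reward, with
weights proportional to γN and 1; otherwise it does not change. -/
lemma discMean_succ_le (hγ : 0 < γ) {r : ℕ → ℝ} {t : ℕ} {a : Fin K} {V : ℝ}
    (hm : discMean γ A r t a ≤ V) (hr : r (t + 1) ≤ V) : discMean γ A r (t + 1) a ≤ V := by
  by_cases h : A (t + 1) = a
  · have hN := discCount_nonneg hγ.le A t a
    have h1 : discCount γ A (t + 1) a = γ * discCount γ A t a + 1 := by
      rw [discCount_succ]; simp [pullInd, h]
    have h2 := mul_nonneg hγ.le hN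
    rw [discMean_eq_dsum, dsum_succ, ← discMean_mul_discCount hγ, h1, div_le_iff₀ (by linarith)]
    have : pullInd A a (t + 1) = 1 := by simp [pullInd, h]
    rw [this]
    nlinarith
  · rw [discMean_succ_of_ne hγ h]; exact hm

/-- The discounted number of pulls made while the discounted count is below `h` is at most
`h + 1`. -/
lemma dsum_low_le (hγ : 0 ≤ γ) (hγ1 : γ ≤ 1) (A : ℕ → Fin K) (a : Fin K) {h : ℝ} (hh : 0 ≤ h)
    (t : ℕ) :
    dsum γ (fun s => if A s = a ∧ discCount γ A (s - 1) a < h then 1 else 0) t ≤ h + 1 := by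
  induction t with
  | zero => rw [dsum_zero]; linarith
  | succ t ih =>
    rw [dsum_succ]
    have h0 : 0 ≤ dsum γ (fun s => if A s = a ∧ discCount γ A (s - 1) a < h then (1 : ℝ) else 0) t :=
      dsum_nonneg hγ fun s _ => by split_ifs <;> norm_num
    simp only [Nat.add_sub_cancel]
    split_ifs with hc
    -- At a low pull the sum over earlier low pulls is dominated by the full count, which is below
    -- h; hence the new value is at most γh + 1.
    · have h1 : dsum γ (fun s => if A s = a ∧ discCount γ A (s - 1) a < h then (1 : ℝ) else 0) t
          ≤ discCount γ A t a := by
        rw [discCount_eq_dsum]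
        refine dsum_mono hγ fun s _ => ?_
        by_cases hs : A s = a
        · simp only [pullInd, hs, true_and, if_true]; split_ifs <;> norm_num
        · simp [pullInd, hs]
      nlinarith [hc.2]
    · nlinarith

/-- The number of pulls made while the discounted count is below `h`. -/
lemma sum_low_le (hγ : 0 ≤ γ) (hγ1 : γ ≤ 1) (A : ℕ → Fin K) (a : Fin K) {h : ℝ} (hh : 0 ≤ h)
    (T : ℕ) :
    ∑ t ∈ Finset.range T, (if A (t + 1) = a ∧ discCount γ A t a < h then (1 : ℝ) else 0)
      ≤ (h + 1) * (1 + (1 - γ) * T) := by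
  have h1 := sum_eq_dsum γ
    (fun s => if A s = a ∧ discCount γ A (s - 1) a < h then (1 : ℝ) else 0) T
  simp only [Nat.add_sub_cancel] at h1
  rw [h1]
  have h2 := dsum_low_le hγ hγ1 A a hh T
  have h3 : ∑ t ∈ Finset.range T,
      dsum γ (fun s => if A s = a ∧ discCount γ A (s - 1) a < h then (1 : ℝ) else 0) t
      ≤ T * (h + 1) := by
    refine (Finset.sum_le_sum fun t _ => dsum_low_le hγ hγ1 A a hh t).trans ?_
    rw [Finset.sum_const, Finset.card_range, nsmul_eq_mul]
  nlinarith

/-- Discounted sum of the inverse square roots of the discounted counts met at the pulls of an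
arm. -/
lemma dsum_inv_sqrt_le (hγ : 0 ≤ γ) (hγ1 : γ ≤ 1) (A : ℕ → Fin K) (a : Fin K) (t : ℕ) :
    dsum γ (fun s => if A s = a ∧ 1 / 2 ≤ discCount γ A (s - 1) a
      then 1 / √(discCount γ A (s - 1) a) else 0) t ≤ 3 * √(discCount γ A t a) := by
  induction t with
  | zero => rw [dsum_zero]; positivity
  | succ t ih =>
    rw [dsum_succ, discCount_succ]
    simp only [Nat.add_sub_cancel]
    set N := discCount γ A t a
    have hN : 0 ≤ N := discCount_nonneg hγ A t a
    have hs : √N ^ 2 = N := Real.sq_sqrt hN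
    have hs0 := Real.sqrt_nonneg N
    have key : γ * (3 * √N) ≤ 3 * √(γ * N + pullInd A a (t + 1)) := by
      have : γ * √N ≤ √(γ * N + pullInd A a (t + 1)) := by
        refine Real.le_sqrt_of_sq_le ?_
        have := pullInd_nonneg A a (t + 1)
        rw [mul_pow, hs]
        nlinarith [mul_nonneg (mul_nonneg hγ hN) (sub_nonneg.2 hγ1)]
      linarith
    have ih' := mul_le_mul_of_nonneg_left ih hγ
    split_ifs with hc
    · refine (add_le_add_left ih' _).trans ?_
      have h1 : pullInd A a (t + 1) = 1 := by simp [pullInd, hc.1]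
      rw [h1]
      have hpos : 0 < √N := Real.sqrt_pos.2 (by linarith [hc.2])
      -- Discrete form of ∫ dN/√N. After squaring, the cross term is at most 2/3 and, because N ≥
      -- 1/2, the last term at most 2/9, so together they stay below 1; this is what the constant 3
      -- buys.
      have : γ * √N + 1 / (3 * √N) ≤ √(γ * N + 1) := by
        refine Real.le_sqrt_of_sq_le ?_
        have e : (γ * √N + 1 / (3 * √N)) ^ 2 = γ ^ 2 * N + 2 * γ / 3 + 1 / (9 * N) := by
          have : (γ * √N + 1 / (3 * √N)) ^ 2
              = γ ^ 2 * √N ^ 2 + 2 * γ / 3 + 1 / (9 * √N ^ 2) := by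
            field_simp; ring
          rw [this, hs]
        have e2 : 1 / (9 * N) ≤ 2 / 9 := by
          rw [div_le_div_iff₀ (by linarith [hc.2]) (by norm_num)]; linarith [hc.2]
        rw [e]
        nlinarith [mul_nonneg (mul_nonneg hγ hN) (sub_nonneg.2 hγ1)]
      have e3 : 1 / √N = 3 * (1 / (3 * √N)) := by field_simp
      rw [e3]
      linarith
    · linarith

end Statistics

/-! ### Drift along one trajectory -/

section Drift

variable {K T : ℕ} {γ ξ : ℝ} {l : NNReal} {f : ℕ → ℝ → ℝ} {x : ℕ → Fin K → ℝ} {A g : ℕ → Fin K}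
  {χ r : ℕ → ℝ}

lemma IsIncentivizedDUCB.compensation_eq (h : IsIncentivizedDUCB T γ ξ f x A g χ r) {t : ℕ}
    (ht : t < T) :
    χ (t + 1) = discMean γ A r t (g (t + 1)) - discMean γ A r t (A (t + 1)) := by
  rw [h.compensation t ht]
  split_ifs with hc
  · rw [hc, sub_self]
  · rfl

lemma IsIncentivizedDUCB.compensation_nonneg (h : IsIncentivizedDUCB T γ ξ f x A g χ r) {t : ℕ}
    (ht : t < T) : 0 ≤ χ (t + 1) := by
  rw [h.compensation_eq ht]
  linarith [h.greedy t ht (A (t + 1))]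

lemma IsIncentivizedDUCB.reward_eq (h : IsIncentivizedDUCB T γ ξ f x A g χ r)
    (hf : IsDrift T l f) {t : ℕ} (ht : t < T) :
    r (t + 1) = x (t + 1) (A (t + 1)) + f (t + 1) (χ (t + 1)) := by
  rw [h.reward t ht]
  split_ifs with hc
  · rw [h.compensation t ht, if_pos hc, (hf (t + 1) (Finset.mem_Icc.2 ⟨by omega, ht⟩)).1, add_zero]
  · rfl

lemma IsIncentivizedDUCB.drift_nonneg (h : IsIncentivizedDUCB T γ ξ f x A g χ r)
    (hf : IsDrift T l f) {t : ℕ} (ht : t < T) :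
    0 ≤ r (t + 1) - x (t + 1) (A (t + 1)) := by
  obtain ⟨h0, hm, -⟩ := hf (t + 1) (Finset.mem_Icc.2 ⟨by omega, ht⟩)
  have hχ := h.compensation_nonneg ht
  have := hm (Set.mem_Ici.2 le_rfl) (Set.mem_Ici.2 hχ) hχ
  rw [h.reward_eq hf ht]
  linarith

lemma IsIncentivizedDUCB.drift_le_mul (h : IsIncentivizedDUCB T γ ξ f x A g χ r)
    (hf : IsDrift T l f) {t : ℕ} (ht : t < T) :
    r (t + 1) - x (t + 1) (A (t + 1)) ≤ l * χ (t + 1) := by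
  obtain ⟨h0, -, hl⟩ := hf (t + 1) (Finset.mem_Icc.2 ⟨by omega, ht⟩)
  have hχ := h.compensation_nonneg ht
  have := hl.dist_le_mul _ (Set.mem_Ici.2 hχ) _ (Set.mem_Ici.2 le_rfl)
  rw [Real.dist_eq, Real.dist_eq, h0, sub_zero, sub_zero, abs_of_nonneg hχ] at this
  rw [h.reward_eq hf ht]
  linarith [le_abs_self (f (t + 1) (χ (t + 1)))]

lemma IsIncentivizedDUCB.reward_nonneg (h : IsIncentivizedDUCB T γ ξ f x A g χ r)
    (hf : IsDrift T l f) (hx : ∀ t ∈ Finset.Icc 1 T, ∀ a, x t a ∈ Set.Icc (0 : ℝ) 1) {s : ℕ}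
    (hs : s ∈ Finset.Icc 1 T) : 0 ≤ r s := by
  have hs' := Finset.mem_Icc.1 hs
  obtain ⟨t, rfl⟩ : ∃ t, s = t + 1 := ⟨s - 1, by omega⟩
  linarith [h.drift_nonneg hf (t := t) (by omega), (hx _ hs (A (t + 1))).1]

lemma IsIncentivizedDUCB.discMean_nonneg (h : IsIncentivizedDUCB T γ ξ f x A g χ r)
    (hf : IsDrift T l f) (hγ : 0 ≤ γ)
    (hx : ∀ t ∈ Finset.Icc 1 T, ∀ a, x t a ∈ Set.Icc (0 : ℝ) 1) {t : ℕ} (ht : t ≤ T)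
    (a : Fin K) : 0 ≤ discMean γ A r t a :=
  IncentivizedBandit.discMean_nonneg hγ (fun _ hs => h.reward_nonneg hf hx
    (Finset.mem_Icc.2 ⟨(Finset.mem_Icc.1 hs).1, (Finset.mem_Icc.1 hs).2.trans ht⟩)) a

/-- The drift is controlled by any bound on the empirical averages. -/
lemma IsIncentivizedDUCB.drift_le_of_mean_le (h : IsIncentivizedDUCB T γ ξ f x A g χ r)
    (hf : IsDrift T l f) (hγ : 0 ≤ γ)
    (hx : ∀ t ∈ Finset.Icc 1 T, ∀ a, x t a ∈ Set.Icc (0 : ℝ) 1) {t : ℕ} (ht : t < T) {V : ℝ}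
    (hV : ∀ b, discMean γ A r t b ≤ V) :
    r (t + 1) - x (t + 1) (A (t + 1)) ≤ l * V := by
  refine (h.drift_le_mul hf ht).trans (mul_le_mul_of_nonneg_left ?_ l.2)
  rw [h.compensation_eq ht]
  linarith [hV (g (t + 1)), h.discMean_nonneg hf hγ hx ht.le (A (t + 1))]

lemma confRadius_nonneg (γ ξ : ℝ) (A : ℕ → Fin K) (t : ℕ) (a : Fin K) :
    0 ≤ confRadius γ ξ A t a := by
  unfold confRadius; positivity

/-- The drift is controlled by the confidence radius of the recommended arm. -/
lemma IsIncentivizedDUCB.drift_le_confRadius (h : IsIncentivizedDUCB T γ ξ f x A g χ r)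
    (hf : IsDrift T l f) {t : ℕ} (ht : t < T) (hK : K ≤ t) :
    r (t + 1) - x (t + 1) (A (t + 1)) ≤ l * confRadius γ ξ A t (A (t + 1)) := by
  refine (h.drift_le_mul hf ht).trans (mul_le_mul_of_nonneg_left ?_ l.2)
  rw [h.compensation_eq ht]
  -- The greedy arm loses the UCB comparison, so its lead in average is at most the radius of the
  -- recommended arm.
  have h1 := h.recommend t ht hK (g (t + 1))
  unfold ucb at h1
  linarith [confRadius_nonneg γ ξ A t (g (t + 1))]

/-- An arm pulled before is pulled again only after the initialization. -/
lemma IsIncentivizedDUCB.le_of_pulled (h : IsIncentivizedDUCB T γ ξ f x A g χ r) {s t : ℕ}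
    (hs : 1 ≤ s) (hst : s ≤ t) (ht : t < T) (hA : A s = A (t + 1)) : K ≤ t := by
  by_contra! hK
  have h1 := h.init t ht hK
  have h2 := h.init (s - 1) (by omega) (by omega)
  rw [show s - 1 + 1 = s by omega, hA] at h2
  omega

lemma IsIncentivizedDUCB.le_of_discCount_ne_zero (h : IsIncentivizedDUCB T γ ξ f x A g χ r)
    {t : ℕ} (ht : t < T) (hN : discCount γ A t (A (t + 1)) ≠ 0) : K ≤ t := by
  obtain ⟨s, hs, hst, hA⟩ := exists_pull_of_discCount_pos hN
  exact h.le_of_pulled hs hst ht hA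

/-- After the initialization every arm has been pulled. -/
lemma IsIncentivizedDUCB.discCount_pos (h : IsIncentivizedDUCB T γ ξ f x A g χ r) (hγ : 0 < γ)
    {t : ℕ} (ht : t ≤ T) (hK : K ≤ t) (a : Fin K) : 0 < discCount γ A t a := by
  have h1 := h.init a (by omega) a.2
  exact (pow_pos hγ _).trans_le
    (pow_le_discCount hγ.le A (s := a + 1) (by omega) (by omega) (Fin.ext h1))

lemma log_discTotal_le (hγ : 0 < γ) (hγ1 : γ < 1) (A : ℕ → Fin K) (t : ℕ) :
    Real.log (discTotal γ A t) ≤ Real.log (1 / (1 - γ)) := by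
  rw [discTotal_eq_dsum]
  rcases t with _ | t
  · rw [dsum_zero, Real.log_zero]
    exact Real.log_nonneg (by rw [le_div_iff₀] <;> linarith)
  · refine Real.log_le_log ?_ (dsum_le_inv hγ.le hγ1 fun _ _ => le_rfl)
    rw [dsum_succ]
    have : 0 ≤ dsum γ (fun _ => 1) t := dsum_nonneg hγ.le fun _ _ => zero_le_one
    positivity

lemma confRadius_le (hγ : 0 < γ) (hγ1 : γ < 1) (hξ : 0 ≤ ξ) (A : ℕ → Fin K) (t : ℕ) (a : Fin K)
    {N : ℝ} (hN : 0 < N) (hNa : N ≤ discCount γ A t a) :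
    confRadius γ ξ A t a ≤ 2 * √(ξ * Real.log (1 / (1 - γ)) / N) := by
  unfold confRadius
  have hL : 0 ≤ Real.log (1 / (1 - γ)) := Real.log_nonneg (by rw [le_div_iff₀] <;> linarith)
  refine mul_le_mul_of_nonneg_left (Real.sqrt_le_sqrt ?_) zero_le_two
  calc _ ≤ ξ * Real.log (1 / (1 - γ)) / discCount γ A t a :=
        div_le_div_of_nonneg_right (mul_le_mul_of_nonneg_left (log_discTotal_le hγ hγ1 A t) hξ)
          (hN.le.trans hNa)
    _ ≤ _ := div_le_div_of_nonneg_left (by positivity) hN hNa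

/-- Total discounted drift of an arm, given a bound `R` on the drift of each round. -/
lemma IsIncentivizedDUCB.dsum_drift_le (h : IsIncentivizedDUCB T γ ξ f x A g χ r)
    (hf : IsDrift T l f) (hγ : 0 < γ) (hγ1 : γ < 1) (hξ : 0 ≤ ξ) {R : ℝ} (hR : 0 ≤ R) {t : ℕ}
    (ht : t ≤ T) (hd : ∀ s < t, r (s + 1) - x (s + 1) (A (s + 1)) ≤ R) (a : Fin K) :
    dsum γ (fun s => pullInd A a s * (r s - x s (A s))) t
      ≤ 6 * l * √(ξ * Real.log (1 / (1 - γ))) * √(discCount γ A t a) + 3 / 2 * R := by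
  set Λ := Real.log (1 / (1 - γ))
  have hL : 0 ≤ Λ := Real.log_nonneg (by rw [le_div_iff₀] <;> linarith)
  have h1 := dsum_inv_sqrt_le hγ.le hγ1.le A a t
  have h2 := dsum_low_le hγ.le hγ1.le A a (h := 1 / 2) (by norm_num) t
  -- Split at count 1/2: above it the drift is at most l times the radius, below it at most R.
  have h3 : dsum γ (fun s => pullInd A a s * (r s - x s (A s))) t ≤
      dsum γ (fun s => (2 * l * √(ξ * Λ)) * (if A s = a ∧ 1 / 2 ≤ discCount γ A (s - 1) a
        then 1 / √(discCount γ A (s - 1) a) else 0)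
        + R * (if A s = a ∧ discCount γ A (s - 1) a < 1 / 2 then 1 else 0)) t := by
    refine dsum_mono hγ.le fun s hs => ?_
    have hs' := Finset.mem_Icc.1 hs
    obtain ⟨u, rfl⟩ : ∃ u, s = u + 1 := ⟨s - 1, by omega⟩
    simp only [Nat.add_sub_cancel]
    by_cases ha : A (u + 1) = a
    · by_cases hN : 1 / 2 ≤ discCount γ A u a
      · have hK : K ≤ u := h.le_of_discCount_ne_zero (by omega) (by rw [ha]; linarith)
        have e1 := h.drift_le_confRadius hf (by omega : u < T) hK
        have e2 := confRadius_le hγ hγ1 hξ A u a (N := discCount γ A u a) (by linarith) le_rfl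
        rw [ha] at e1
        rw [Real.sqrt_div (by positivity)] at e2
        have e3 := mul_le_mul_of_nonneg_left e2 l.2
        simp only [pullInd, ha, hN, if_true, not_lt.2 hN, if_false, true_and, one_mul, mul_zero,
          add_zero]
        refine (e1.trans e3).trans (le_of_eq ?_)
        simp only [NNReal.val_eq_coe]
        ring
      · have := hd u (by omega)
        rw [ha] at this
        simp only [pullInd, ha, hN, not_le.1 hN, if_true, if_false, and_false, true_and, mul_zero,
          zero_add, one_mul, mul_one]
        exact this
    · simp [pullInd, ha]
  rw [dsum_add, dsum_const_mul, dsum_const_mul] at h3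
  have h4 := mul_le_mul_of_nonneg_left h1 (show 0 ≤ 2 * (l : ℝ) * √(ξ * Λ) by positivity)
  have h5 := mul_le_mul_of_nonneg_left h2 hR
  linarith

/-- Empirical average of an arm compared with the discounted average of its true rewards. -/
lemma IsIncentivizedDUCB.discMean_mul_le (h : IsIncentivizedDUCB T γ ξ f x A g χ r)
    (hf : IsDrift T l f) (hγ : 0 < γ) (hγ1 : γ < 1) (hξ : 0 ≤ ξ) {R : ℝ} (hR : 0 ≤ R) {t : ℕ}
    (ht : t ≤ T) (hd : ∀ s < t, r (s + 1) - x (s + 1) (A (s + 1)) ≤ R) (a : Fin K) :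
    discMean γ A r t a * discCount γ A t a ≤ dsum γ (fun s => pullInd A a s * x s a) t
      + 6 * l * √(ξ * Real.log (1 / (1 - γ))) * √(discCount γ A t a) + 3 / 2 * R := by
  have h1 := h.dsum_drift_le hf hγ hγ1 hξ hR ht hd a
  rw [discMean_mul_discCount hγ]
  have h2 : dsum γ (fun s => pullInd A a s * r s) t = dsum γ (fun s => pullInd A a s * x s a) t
      + dsum γ (fun s => pullInd A a s * (r s - x s (A s))) t := by
    rw [← dsum_add]
    refine dsum_congr fun s _ => ?_
    by_cases ha : A s = a
    · simp [pullInd, ha]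
    · simp [pullInd, ha]
  linarith

/-- Drift is non-negative, so it can only raise an average; the lower estimate needs no drift bound.
-/
lemma IsIncentivizedDUCB.le_discMean_mul (h : IsIncentivizedDUCB T γ ξ f x A g χ r)
    (hf : IsDrift T l f) (hγ : 0 < γ) {t : ℕ} (ht : t ≤ T) (a : Fin K) :
    dsum γ (fun s => pullInd A a s * x s a) t ≤ discMean γ A r t a * discCount γ A t a := by
  rw [discMean_mul_discCount hγ]
  refine dsum_mono hγ.le fun s hs => ?_
  have hs' := Finset.mem_Icc.1 hs
  obtain ⟨u, rfl⟩ : ∃ u, s = u + 1 := ⟨s - 1, by omega⟩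
  have := h.drift_nonneg hf (t := u) (by omega)
  by_cases ha : A (u + 1) = a
  · rw [ha] at this; simpa [pullInd, ha] using this
  · simp [pullInd, ha]

/-- In a window short enough for the discounting not to matter, the empirical averages grow by at
most the factor `(1 + l) ^ K`, since only the first pull of each arm in the window can come with a
large compensation. -/
lemma IsIncentivizedDUCB.mean_le_of_window (h : IsIncentivizedDUCB T γ ξ f x A g χ r)
    (hf : IsDrift T l f) (hγ : 0 < γ) (hγ1 : γ < 1) (hξ : 0 ≤ ξ)
    (hx : ∀ t ∈ Finset.Icc 1 T, ∀ a, x t a ∈ Set.Icc (0 : ℝ) 1) {W u : ℕ}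
    (hW : 1 / 2 ≤ γ ^ W) {Q : ℝ}
    (hQ : 1 + l * (2 * √(ξ * Real.log (1 / (1 - γ)) / (1 / 2))) ≤ Q)
    (hu : ∀ b, discMean γ A r u b ≤ Q) (n : ℕ) (hn : n ≤ W) (hT : u + n ≤ T) :
    ∀ b, discMean γ A r (u + n) b
      ≤ (1 + l : ℝ) ^ ((Finset.Ioc u (u + n)).image A).card * Q := by
  have hQ1 : 1 ≤ Q := le_trans (by have := l.2; simp only [le_add_iff_nonneg_right]; positivity) hQ
  have hl : (1 : ℝ) ≤ 1 + l := by simp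
  induction n with
  | zero => simpa using hu
  | succ n ih =>
    intro b
    have ih := ih (by omega) (by omega)
    rw [← add_assoc]
    set S := (Finset.Ioc u (u + n)).image A with hS
    have hS' : (Finset.Ioc u (u + n + 1)).image A = insert (A (u + n + 1)) S := by
      rw [hS, ← Finset.image_insert]
      congr 1
      ext s; simp only [Finset.mem_Ioc, Finset.mem_insert]; omega
    have hxle := (hx (u + n + 1) (Finset.mem_Icc.2 ⟨by omega, by omega⟩) (A (u + n + 1))).2
    have hpow := one_le_pow₀ hl (n := S.card)
    rw [hS']
    -- An arm already pulled in the window has count at least γ^W ≥ 1/2, so its radius is controlled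
    -- and its reward is at most Q. A new arm may have drift up to l times the current bound, which
    -- costs one factor 1 + l.
    by_cases hmem : A (u + n + 1) ∈ S
    · rw [Finset.insert_eq_of_mem hmem]
      refine discMean_succ_le hγ (ih b) ?_
      rw [hS, Finset.mem_image] at hmem
      obtain ⟨s, hs, hA⟩ := hmem
      rw [Finset.mem_Ioc] at hs
      have hK := h.le_of_pulled (by omega) hs.2 (by omega) hA
      have hN : 1 / 2 ≤ discCount γ A (u + n) (A (u + n + 1)) :=
        (hW.trans (pow_le_pow_of_le_one hγ.le hγ1.le (by omega))).trans
          (pow_le_discCount hγ.le A (by omega) hs.2 hA)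
      have e1 := h.drift_le_confRadius hf (by omega : u + n < T) hK
      have e2 := mul_le_mul_of_nonneg_left
        (confRadius_le hγ hγ1 hξ A (u + n) (A (u + n + 1)) (by norm_num) hN) l.2
      simp only [NNReal.val_eq_coe] at e2
      nlinarith
    · rw [Finset.card_insert_of_notMem hmem, pow_succ]
      have hmono : (1 + l : ℝ) ^ S.card * Q ≤ (1 + l : ℝ) ^ S.card * (1 + l) * Q := by
        refine mul_le_mul_of_nonneg_right ?_ (by linarith)
        nlinarith
      refine discMean_succ_le hγ ((ih b).trans hmono) ?_
      have e1 := h.drift_le_of_mean_le hf hγ.le hx (by omega : u + n < T) ih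
      nlinarith
end Drift

/-! ### Uniform bound on the drift of a single round -/

/-- In every window of more than `2 K (H + 1)` rounds that is short enough for the discounting not
to matter, some pulled arm has discounted count at least `H`. -/
lemma exists_pull_of_large_discCount {K : ℕ} {γ : ℝ} (hγ : 0 < γ) (hγ1 : γ < 1) (A : ℕ → Fin K)
    {H : ℝ} (hH : 0 ≤ H) {W : ℕ} (hW : 2 * K * (H + 1) < W) (hγW : 1 / 2 ≤ γ ^ W) (t : ℕ) :
    ∃ u, t ≤ u ∧ u < t + W ∧ H ≤ discCount γ A u (A (u + 1)) := by
  -- If all W pulls of the window were made at counts below H, their discounted number would be at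
  -- least W/2, whereas K arms allow at most K (H + 1).
  by_contra! hc
  have h1 : ∑ a, dsum γ (fun s => if A s = a ∧ discCount γ A (s - 1) a < H then 1 else 0) (t + W)
      ≤ K * (H + 1) := by
    refine (Finset.sum_le_sum fun a _ => dsum_low_le hγ.le hγ1.le A a hH (t + W)).trans ?_
    simp [mul_add]
  have h2 : ∑ a, dsum γ (fun s => if A s = a ∧ discCount γ A (s - 1) a < H then 1 else 0) (t + W)
      = dsum γ (fun s => if discCount γ A (s - 1) (A s) < H then 1 else 0) (t + W) := by
    unfold dsum
    rw [Finset.sum_comm]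
    refine Finset.sum_congr rfl fun s _ => ?_
    rw [← Finset.mul_sum]
    congr 1
    rw [Finset.sum_eq_single (A s)]
    · simp
    · intro b _ hb; simp [hb.symm]
    · simp
  have h3 : dsum γ (fun s => if discCount γ A (t + s - 1) (A (t + s)) < H then (1 : ℝ) else 0) W
      = dsum γ (fun _ => 1) W := by
    refine dsum_congr fun s hs => ?_
    have hs' := Finset.mem_Icc.1 hs
    have := hc (t + s - 1) (by omega) (by omega)
    rw [show t + s - 1 + 1 = t + s by omega] at this
    simp [this]
  have h4 : (W : ℝ) * (1 / 2) ≤ dsum γ (fun _ => 1) W := by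
    unfold dsum
    have : ∑ s ∈ Finset.Icc 1 W, (1 / 2 : ℝ) ≤ ∑ s ∈ Finset.Icc 1 W, γ ^ (W - s) * 1 :=
      Finset.sum_le_sum fun s _ => by
        rw [mul_one]
        exact hγW.trans (pow_le_pow_of_le_one hγ.le hγ1.le (by omega))
    simpa using this
  have h5 := dsum_add_time γ
    (fun s => if discCount γ A (s - 1) (A s) < H then (1 : ℝ) else 0) t W
  rw [h3] at h5
  have h6 : 0 ≤ dsum γ (fun s => if discCount γ A (s - 1) (A s) < H then (1 : ℝ) else 0) t :=
    dsum_nonneg hγ.le fun s _ => by split_ifs <;> norm_num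
  have h7 := mul_nonneg (pow_nonneg hγ.le W) h6
  linarith

/-- The constant in the bound on the drift of a single round. -/
def driftConst (K : ℕ) (ξ : ℝ) (l : NNReal) : ℝ :=
  2 * (1 + l : ℝ) ^ (K + 1) * (1 + (9 * l + 2) * √ξ)

/-- Length of a window in which some pulled arm is known to have a large discounted count. -/
def windowLength (K : ℕ) (l : NNReal) : ℕ :=
  ⌈2 * K * (3 * (1 + l : ℝ) ^ (K + 1) + 1)⌉₊ + 1

lemma driftConst_nonneg (K : ℕ) (ξ : ℝ) (l : NNReal) : 0 ≤ driftConst K ξ l := by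
  unfold driftConst; positivity

section Drift

variable {K T : ℕ} {γ ξ : ℝ} {l : NNReal} {f : ℕ → ℝ → ℝ} {x : ℕ → Fin K → ℝ} {A g : ℕ → Fin K}
  {χ r : ℕ → ℝ}

/-- The drift never exceeds a constant times `log (1 / (1 - γ))`. -/
theorem IsIncentivizedDUCB.drift_le (h : IsIncentivizedDUCB T γ ξ f x A g χ r)
    (hf : IsDrift T l f) (hγ : 0 < γ) (hγ1 : γ < 1) (hξ : 0 ≤ ξ)
    (hx : ∀ t ∈ Finset.Icc 1 T, ∀ a, x t a ∈ Set.Icc (0 : ℝ) 1)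
    (hW : 1 / 2 ≤ γ ^ windowLength K l) (hL : 1 ≤ Real.log (1 / (1 - γ))) :
    ∀ t < T, r (t + 1) - x (t + 1) (A (t + 1))
      ≤ driftConst K ξ l * Real.log (1 / (1 - γ)) := by
  intro t
  induction t using Nat.strong_induction_on with
  | _ t ih =>
  intro ht
  set Λ := Real.log (1 / (1 - γ)) with hΛ
  set R := driftConst K ξ l * Λ with hR
  have hR0 : 0 ≤ R := mul_nonneg (driftConst_nonneg K ξ l) (by linarith)
  set B : ℝ := (1 + l : ℝ) ^ (K + 1) with hB
  have hl1 : (1 : ℝ) ≤ 1 + l := by simp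
  have hl0 : (0 : ℝ) ≤ l := l.2
  have hB1 : 1 ≤ B := one_le_pow₀ hl1
  set q := √(ξ * Λ) with hq
  have hq0 : 0 ≤ q := Real.sqrt_nonneg _
  have hqΛ : q ≤ √ξ * Λ := by
    rw [hq, Real.sqrt_mul hξ]
    refine mul_le_mul_of_nonneg_left ?_ (Real.sqrt_nonneg _)
    rw [Real.sqrt_le_left (by linarith)]
    nlinarith
  -- The coefficient 9l + 2 covers both the 6l + 2 needed at the start of the window and the 3l
  -- needed for repeated pulls inside it. The last term is half of R after multiplication by B,
  -- which closes the induction.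
  set Q : ℝ := 1 + (9 * l + 2) * q + R / (2 * B) with hQ
  have hRB : 0 ≤ R / (2 * B) := by positivity
  have hQ1 : 1 + l * (2 * √(ξ * Λ / (1 / 2))) ≤ Q := by
    have e : √(ξ * Λ / (1 / 2)) ≤ 3 / 2 * q := by
      rw [Real.sqrt_le_left (by positivity), mul_pow, hq, Real.sq_sqrt (by positivity)]
      have : 0 ≤ ξ * Λ := by positivity
      linarith
    nlinarith [mul_nonneg hl0 hq0, mul_le_mul_of_nonneg_left e hl0]
  have hBQ : B * Q ≤ R := by
    have e1 : B * (R / (2 * B)) = R / 2 := by field_simp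
    have e2 : 1 + (9 * l + 2) * q ≤ (1 + (9 * l + 2) * √ξ) * Λ := by
      nlinarith [mul_le_mul_of_nonneg_left hqΛ (show (0 : ℝ) ≤ 9 * l + 2 by positivity)]
    have e3 := mul_le_mul_of_nonneg_left e2 (show 0 ≤ B by linarith)
    have e4 : R = 2 * (B * ((1 + (9 * l + 2) * √ξ) * Λ)) := by
      rw [hR, driftConst, ← hB]; ring
    rw [hQ, mul_add, e1]
    linarith
  -- Early on the window starts at time 0, where all averages are 0 by convention; later it starts
  -- at a pull with count at least 3B.
  have hstart : ∃ u n, u + n = t ∧ n ≤ windowLength K l ∧ ∀ b, discMean γ A r u b ≤ Q := by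
    rcases lt_or_ge t (windowLength K l) with hlt | hge
    · refine ⟨0, t, by omega, hlt.le, fun b => ?_⟩
      rw [discMean_zero]
      positivity
    · have hlen : 2 * K * (3 * B + 1) < windowLength K l := by
        unfold windowLength
        push_cast
        rw [← hB]
        linarith [Nat.le_ceil (2 * K * (3 * B + 1))]
      obtain ⟨u, hu1, hu2, hu3⟩ := exists_pull_of_large_discCount hγ hγ1 A
        (H := 3 * B) (by linarith) hlen hW (t + 1 - windowLength K l)
      refine ⟨u, t - u, by omega, by omega, fun b => ?_⟩
      set N := discCount γ A u (A (u + 1)) with hN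
      have hK : K ≤ u := h.le_of_discCount_ne_zero (by omega) (by rw [← hN]; linarith)
      have e1 := h.recommend u (by omega) hK b
      unfold ucb at e1
      have e2 := confRadius_nonneg γ ξ A u b
      have e3 := confRadius_le hγ hγ1 hξ A u (A (u + 1)) (N := 1) one_pos (by linarith)
      rw [div_one, ← hΛ, ← hq] at e3
      have e4 := h.discMean_mul_le hf hγ hγ1 hξ hR0 (t := u) (by omega)
        (fun s hs => ih s (by omega) (by omega)) (A (u + 1))
      rw [← hN, ← hΛ, ← hq] at e4
      have e5 : dsum γ (fun s => pullInd A (A (u + 1)) s * x s (A (u + 1))) u ≤ N := by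
        rw [hN, discCount_eq_dsum]
        refine dsum_mono hγ.le fun s hs => ?_
        have hs' := Finset.mem_Icc.1 hs
        have := (hx s (Finset.mem_Icc.2 ⟨hs'.1, by omega⟩) (A (u + 1))).2
        nlinarith [pullInd_nonneg A (A (u + 1)) s]
      have e6 : √N ≤ N := by
        rw [Real.sqrt_le_left (by linarith)]; nlinarith
      -- The threshold 3B is chosen so that the uncontrolled drift 3R/2, divided by the count,
      -- leaves only R/(2B).
      have e7 : 3 / 2 * R ≤ R / (2 * B) * N := by
        have : R / (2 * B) * (3 * B) = 3 / 2 * R := by field_simp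
        rw [← this]
        exact mul_le_mul_of_nonneg_left hu3 hRB
      have e8 : discMean γ A r u (A (u + 1)) * N ≤ (1 + 6 * l * q + R / (2 * B)) * N := by
        have := mul_le_mul_of_nonneg_left e6 (show 0 ≤ 6 * (l : ℝ) * q by positivity)
        nlinarith
      have e9 := le_of_mul_le_mul_right e8 (by linarith)
      nlinarith [mul_nonneg hl0 hq0]
  obtain ⟨u, n, rfl, hn, hu⟩ := hstart
  have e1 := h.mean_le_of_window hf hγ hγ1 hξ hx hW hQ1 hu n hn ht.le
  have e2 := h.drift_le_of_mean_le hf hγ.le hx ht (V := (1 + l : ℝ) ^ K * Q) fun b => by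
    refine (e1 b).trans (mul_le_mul_of_nonneg_right ?_ (by positivity))
    exact pow_le_pow_right₀ hl1 ((Finset.card_le_univ _).trans (by simp))
  refine e2.trans (le_trans ?_ hBQ)
  rw [hB, pow_succ]
  have e3 : 0 ≤ (1 + l : ℝ) ^ K * Q := by positivity
  have e4 : (1 + l : ℝ) ^ K * (1 + l) * Q = l * ((1 + l) ^ K * Q) + (1 + l) ^ K * Q := by ring
  rw [e4]
  exact le_add_of_nonneg_right e3

end Drift

/-! ### Concentration of the discounted rewards -/

section Concentration

variable {Ω : Type*} [mΩ : MeasurableSpace Ω] {K T : ℕ} {P : Measure Ω}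
  {ℱ : Filtration ℕ mΩ} {X : ℕ → Fin K → Ω → ℝ} {A : ℕ → Ω → Fin K} {γ : ℝ}

/-- Discounted sum of the centred rewards of arm `a` in the rounds in which it is pulled. -/
def discNoise (γ : ℝ) (P : Measure Ω) (X : ℕ → Fin K → Ω → ℝ) (A : ℕ → Ω → Fin K) (t : ℕ)
    (a : Fin K) (ω : Ω) : ℝ :=
  dsum γ (fun s => pullInd (fun s => A s ω) a s * (X s a ω - meanReward P X s a)) t

/-- Exponent of the supermartingale that controls weighted sums of centred rewards. -/
def logSupermartingale (P : Measure Ω) (X : ℕ → Fin K → Ω → ℝ) (A : ℕ → Ω → Fin K) (w : ℕ → ℝ)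
    (a : Fin K) (k : ℕ) (ω : Ω) : ℝ :=
  ∑ s ∈ Finset.Icc 1 k, pullInd (fun s => A s ω) a s *
    (w s * (X s a ω - meanReward P X s a) - w s ^ 2 / 8)

lemma measurable_pullInd (hA : ∀ t < T, Measurable[ℱ t] (A (t + 1))) {s k : ℕ} (hs : 1 ≤ s)
    (hsT : s ≤ T) (hk : s ≤ k + 1) (a : Fin K) :
    Measurable[ℱ k] (fun ω => pullInd (fun s => A s ω) a s) := by
  have h1 : Measurable[ℱ k] (A s) := by
    have := hA (s - 1) (by omega)
    rw [show s - 1 + 1 = s by omega] at this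
    exact this.mono (ℱ.mono (by omega)) le_rfl
  exact (measurable_of_countable (fun b : Fin K => if b = a then (1 : ℝ) else 0)).comp h1

lemma measurable_logSupermartingale (hX : IsRewardProcess T P ℱ X)
    (hA : ∀ t < T, Measurable[ℱ t] (A (t + 1))) (w : ℕ → ℝ) (a : Fin K) {k : ℕ} (hk : k ≤ T) :
    Measurable[ℱ k] (logSupermartingale P X A w a k) := by
  unfold logSupermartingale
  refine Finset.measurable_fun_sum _ fun s hs => ?_
  have hs' := Finset.mem_Icc.1 hs
  have h1 : Measurable[ℱ k] (X s a) :=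
    (hX.measurable s (Finset.mem_Icc.2 ⟨hs'.1, by omega⟩) a).mono (ℱ.mono hs'.2) le_rfl
  exact (measurable_pullInd hA hs'.1 (by omega) (by omega) a).mul
    (((h1.sub_const _).const_mul _).sub_const _)

variable [IsProbabilityMeasure P]

/-- Hoeffding's lemma: a variable with values in [0, 1] has sub-Gaussian variance proxy 1/4. -/
lemma lintegral_exp_centred_le (hX : IsRewardProcess T P ℱ X) {s : ℕ} (hs : s ∈ Finset.Icc 1 T)
    (a : Fin K) (c : ℝ) :
    ∫⁻ ω, ENNReal.ofReal (Real.exp (c * (X s a ω - meanReward P X s a) - c ^ 2 / 8)) ∂P ≤ 1 := by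
  have hm : Measurable (X s a) := (hX.measurable s hs a).mono (ℱ.le s) le_rfl
  have h1 := hasSubgaussianMGF_of_mem_Icc (μ := P) hm.aemeasurable (hX.mem_unit s hs a)
  have h2 := h1.mgf_le c
  have h3 := h1.integrable_exp_mul c
  have e : ∀ ω, Real.exp (c * (X s a ω - meanReward P X s a) - c ^ 2 / 8)
      = Real.exp (-(c ^ 2 / 8)) * Real.exp (c * (X s a ω - ∫ ω, X s a ω ∂P)) := fun ω => by
    rw [← Real.exp_add]; congr 1; unfold meanReward; ring
  simp_rw [e]
  rw [← ofReal_integral_eq_lintegral_ofReal (h3.const_mul _)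
    (Filter.Eventually.of_forall fun ω => by positivity), integral_const_mul]
  rw [ENNReal.ofReal_le_one]
  unfold mgf at h2
  calc _ ≤ Real.exp (-(c ^ 2 / 8)) * _ := mul_le_mul_of_nonneg_left h2 (Real.exp_pos _).le
    _ = 1 := by
      rw [← Real.exp_add, ← Real.exp_zero]
      congr 1
      norm_num
      ring

/-- The choice of arm in round k + 1 is known at time k while its reward is independent of that
information. On the event that a is pulled the new factor thus integrates separately, to at most 1;
elsewhere it equals 1. -/
lemma lintegral_exp_logSupermartingale_le (hX : IsRewardProcess T P ℱ X)
    (hA : ∀ t < T, Measurable[ℱ t] (A (t + 1))) (w : ℕ → ℝ) (a : Fin K) {k : ℕ} (hk : k ≤ T) :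
    ∫⁻ ω, ENNReal.ofReal (Real.exp (logSupermartingale P X A w a k ω)) ∂P ≤ 1 := by
  induction k with
  | zero => simp [logSupermartingale]
  | succ k ih =>
    have hk1 : k + 1 ∈ Finset.Icc 1 T := Finset.mem_Icc.2 ⟨by omega, hk⟩
    set F : Ω → ENNReal := fun ω => ENNReal.ofReal (Real.exp (logSupermartingale P X A w a k ω))
    set G : Ω → ENNReal := fun ω => ENNReal.ofReal (Real.exp
      (w (k + 1) * (X (k + 1) a ω - meanReward P X (k + 1) a) - w (k + 1) ^ 2 / 8))
    have hFm : Measurable[ℱ k] F := ENNReal.measurable_ofReal.comp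
      (Real.measurable_exp.comp (measurable_logSupermartingale hX hA w a (by omega)))
    have hset : MeasurableSet[ℱ k] {ω | A (k + 1) ω = a} :=
      (hA k (by omega)) (measurableSet_singleton a)
    have hGm : Measurable[⨆ b, MeasurableSpace.comap (X (k + 1) b) inferInstance] G := by
      have h1 : Measurable[⨆ b, MeasurableSpace.comap (X (k + 1) b) inferInstance]
          (X (k + 1) a) :=
        (comap_measurable (X (k + 1) a)).mono
          (le_iSup (fun b => MeasurableSpace.comap (X (k + 1) b) inferInstance) a) le_rfl
      exact ENNReal.measurable_ofReal.comp
        (Real.measurable_exp.comp (((h1.sub_const _).const_mul _).sub_const _))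
    have hsup : (⨆ b, MeasurableSpace.comap (X (k + 1) b) inferInstance) ≤ mΩ :=
      iSup_le fun b => ((hX.measurable _ hk1 b).mono (ℱ.le _) le_rfl).comap_le
    have hF1m : Measurable[ℱ k] ({ω | A (k + 1) ω = a}.indicator F) := hFm.indicator hset
    have hF1m' : Measurable ({ω | A (k + 1) ω = a}.indicator F) := hF1m.mono (ℱ.le k) le_rfl
    have e : ∀ ω, ENNReal.ofReal (Real.exp (logSupermartingale P X A w a (k + 1) ω))
        = {ω | A (k + 1) ω = a}.indicator F ω * G ω + {ω | A (k + 1) ω = a}ᶜ.indicator F ω := by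
      intro ω
      have e0 : logSupermartingale P X A w a (k + 1) ω = logSupermartingale P X A w a k ω
          + pullInd (fun s => A s ω) a (k + 1) *
            (w (k + 1) * (X (k + 1) a ω - meanReward P X (k + 1) a) - w (k + 1) ^ 2 / 8) := by
        unfold logSupermartingale
        rw [Finset.sum_Icc_succ_top (by omega)]
      rw [e0, Real.exp_add, ENNReal.ofReal_mul (Real.exp_pos _).le]
      by_cases h : A (k + 1) ω = a
      · simp [h, pullInd, F, G]
      · simp [h, pullInd, F]
    have hind := (hX.indep k (by omega)).symm
    calc ∫⁻ ω, ENNReal.ofReal (Real.exp (logSupermartingale P X A w a (k + 1) ω)) ∂P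
        = ∫⁻ ω, {ω | A (k + 1) ω = a}.indicator F ω * G ω ∂P
          + ∫⁻ ω, {ω | A (k + 1) ω = a}ᶜ.indicator F ω ∂P := by
          rw [lintegral_congr e]
          exact lintegral_add_left (hF1m'.mul (hGm.mono hsup le_rfl)) _
      _ = (∫⁻ ω, {ω | A (k + 1) ω = a}.indicator F ω ∂P) * ∫⁻ ω, G ω ∂P
          + ∫⁻ ω, {ω | A (k + 1) ω = a}ᶜ.indicator F ω ∂P := by
          rw [lintegral_mul_eq_lintegral_mul_lintegral_of_independent_measurableSpace
            (ℱ.le k) hsup hind hF1m hGm]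
      _ ≤ (∫⁻ ω, {ω | A (k + 1) ω = a}.indicator F ω ∂P) * 1
          + ∫⁻ ω, {ω | A (k + 1) ω = a}ᶜ.indicator F ω ∂P := by
          gcongr
          exact lintegral_exp_centred_le hX hk1 a _
      _ = ∫⁻ ω, F ω ∂P := by
          rw [mul_one, ← lintegral_add_left hF1m']
          refine lintegral_congr fun ω => ?_
          rw [Set.indicator_self_add_compl_apply]
      _ ≤ 1 := ih (by omega)

/-- Markov's inequality for the exponential with weights c γ^(t - s). Their squares are at most c²
γ^(t - s), so the variance term is bounded by the count with the same discount factor γ. -/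
lemma measureReal_discNoise_ge_le (hX : IsRewardProcess T P ℱ X)
    (hA : ∀ t < T, Measurable[ℱ t] (A (t + 1))) (hγ : 0 ≤ γ) (hγ1 : γ ≤ 1) (a : Fin K) {t : ℕ}
    (ht : t ≤ T) (c y : ℝ) :
    P.real {ω | y ≤ c * discNoise γ P X A t a ω
      - c ^ 2 / 8 * discCount γ (fun s => A s ω) t a} ≤ Real.exp (-y) := by
  set w : ℕ → ℝ := fun s => c * γ ^ (t - s) with hw
  have h1 : {ω | y ≤ c * discNoise γ P X A t a ω - c ^ 2 / 8 * discCount γ (fun s => A s ω) t a}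
      ⊆ {ω | ENNReal.ofReal (Real.exp y)
          ≤ ENNReal.ofReal (Real.exp (logSupermartingale P X A w a t ω))} := by
    intro ω hω
    simp only [Set.mem_ofPred_eq] at hω ⊢
    refine ENNReal.ofReal_le_ofReal (Real.exp_le_exp.2 (hω.trans ?_))
    rw [discCount_eq_dsum]
    unfold discNoise logSupermartingale dsum
    rw [Finset.mul_sum, Finset.mul_sum, ← Finset.sum_sub_distrib]
    refine Finset.sum_le_sum fun s _ => ?_
    have h2 : (γ ^ (t - s)) ^ 2 ≤ γ ^ (t - s) := by
      have h3 := pow_le_one₀ (n := t - s) hγ hγ1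
      have h4 := pow_nonneg hγ (t - s)
      nlinarith
    have h5 := mul_le_mul_of_nonneg_left h2
      (mul_nonneg (pullInd_nonneg (fun s => A s ω) a s) (show 0 ≤ c ^ 2 / 8 by positivity))
    simp only [hw]
    nlinarith
  have h2 := lintegral_exp_logSupermartingale_le hX hA w a ht
  have hmeas : Measurable fun ω =>
      ENNReal.ofReal (Real.exp (logSupermartingale P X A w a t ω)) :=
    ENNReal.measurable_ofReal.comp (Real.measurable_exp.comp
      ((measurable_logSupermartingale hX hA w a ht).mono (ℱ.le t) le_rfl))
  have h3 := meas_ge_le_lintegral_div (μ := P) hmeas.aemeasurable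
    (ε := ENNReal.ofReal (Real.exp y)) (by simp [Real.exp_pos]) ENNReal.ofReal_ne_top
  have h4 : P {ω | y ≤ c * discNoise γ P X A t a ω
      - c ^ 2 / 8 * discCount γ (fun s => A s ω) t a} ≤ ENNReal.ofReal (Real.exp (-y)) := by
    refine (measure_mono h1).trans (h3.trans ?_)
    rw [Real.exp_neg, ENNReal.ofReal_inv_of_pos (Real.exp_pos _), ← one_div]
    exact ENNReal.div_le_div_right h2 _
  exact ENNReal.toReal_le_of_le_ofReal (Real.exp_pos _).le h4

/-- Self-normalized deviation bound for the discounted rewards. -/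
theorem measureReal_abs_discNoise_gt_le (hX : IsRewardProcess T P ℱ X)
    (hA : ∀ t < T, Measurable[ℱ t] (A (t + 1))) (hγ : 0 < γ) (hγ1 : γ < 1) (a : Fin K) {t : ℕ}
    (ht : t ≤ T) {y : ℝ} (hy : y = Real.log (1 / (1 - γ))) :
    P.real {ω | 1 ≤ discCount γ (fun s => A s ω) t a ∧
      √(y * discCount γ (fun s => A s ω) t a) < |discNoise γ P X A t a ω|}
      ≤ 2 * (y + 1) * (1 - γ) := by
  have hy0 : 0 ≤ y := hy ▸ Real.log_nonneg (by rw [le_div_iff₀] <;> linarith)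
  have hexp : Real.exp (-y) = 1 - γ := by
    rw [hy, one_div, Real.log_inv, neg_neg, Real.exp_log (by linarith)]
  set S : ℝ → Set Ω := fun c => {ω | y ≤ c * discNoise γ P X A t a ω
      - c ^ 2 / 8 * discCount γ (fun s => A s ω) t a} with hS
  have hsub : {ω | 1 ≤ discCount γ (fun s => A s ω) t a ∧
      √(y * discCount γ (fun s => A s ω) t a) < |discNoise γ P X A t a ω|}
      -- Peeling: the best slope c depends on the random count N, so one slope of each sign is used
      -- per slice 2^n ≤ √N < 2^(n+1).
      ⊆ ⋃ n ∈ Finset.range (⌊y⌋₊ + 1), (S (√y * (2 / 2 ^ n)) ∪ S (-(√y * (2 / 2 ^ n)))) := by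
    rintro ω ⟨h1, h2⟩
    set N := discCount γ (fun s => A s ω) t a with hN
    set Z := discNoise γ P X A t a ω with hZ
    have hNs : √N ^ 2 = N := Real.sq_sqrt (by linarith)
    have hys : √y ^ 2 = y := Real.sq_sqrt hy0
    obtain ⟨n, hn1, hn2⟩ := exists_nat_pow_near (Real.one_le_sqrt.2 h1) one_lt_two
    -- Only about y slices occur, since e^n ≤ 4^n ≤ N ≤ 1 / (1 - γ) = e^y.
    have hnJ : n < ⌊y⌋₊ + 1 := by
      rw [Nat.lt_succ_iff, Nat.le_floor_iff hy0, hy, Real.le_log_iff_exp_le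
        (by apply one_div_pos.2; linarith)]
      refine le_trans ?_ (discCount_le_inv hγ.le hγ1 (fun s => A s ω) t a)
      rw [← hN, ← hNs]
      calc Real.exp n = Real.exp 1 ^ n := by rw [← Real.exp_nat_mul, mul_one]
        _ ≤ (2 ^ 2) ^ n := pow_le_pow_left₀ (Real.exp_pos _).le
            (by linarith [Real.exp_one_lt_d9]) n
        _ = (2 ^ n) ^ 2 := by rw [← pow_mul, ← pow_mul, mul_comm]
        _ ≤ √N ^ 2 := pow_le_pow_left₀ (by positivity) hn1 2
    have hp : (0 : ℝ) < 2 / 2 ^ n := by positivity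
    have hv1 : 2 ≤ 2 / 2 ^ n * √N := by
      rw [div_mul_eq_mul_div, le_div_iff₀ (by positivity)]; linarith
    have hv2 : 2 / 2 ^ n * √N ≤ 4 := by
      rw [div_mul_eq_mul_div, div_le_iff₀ (by positivity)]
      rw [pow_succ] at hn2; linarith
    set p : ℝ := 2 / 2 ^ n with hpdef
    have key : y ≤ √y * p * |Z| - (√y * p) ^ 2 / 8 * N := by
      rw [Real.sqrt_mul hy0] at h2
      have h3 := mul_le_mul_of_nonneg_left h2.le (show 0 ≤ √y * p by positivity)
      have h4 : √y * p * (√y * √N) = y * (p * √N) := by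
        linear_combination (p * √N) * hys
      have h5 : (√y * p) ^ 2 / 8 * N = y * ((p * √N) ^ 2 / 8) := by
        rw [mul_pow, hys, mul_pow, hNs]; ring
      -- On a slice v = p√N lies in [2, 4], where v - v²/8 ≥ 1.
      have h6 : 1 ≤ p * √N - (p * √N) ^ 2 / 8 := by nlinarith
      have h7 := mul_le_mul_of_nonneg_left h6 hy0
      rw [h5]
      linarith
    rw [Set.mem_iUnion₂]
    refine ⟨n, Finset.mem_range.2 hnJ, ?_⟩
    rcases le_total 0 Z with h0 | h0
    · left
      rw [abs_of_nonneg h0] at key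
      exact key
    · right
      rw [abs_of_nonpos h0] at key
      simp only [hS, Set.mem_ofPred_eq]
      rw [neg_sq]
      linarith
  have hb : ∀ c, P.real (S c) ≤ 1 - γ := fun c => by
    rw [← hexp]; exact measureReal_discNoise_ge_le hX hA hγ.le hγ1.le a ht c y
  calc _ ≤ P.real (⋃ n ∈ Finset.range (⌊y⌋₊ + 1),
        (S (√y * (2 / 2 ^ n)) ∪ S (-(√y * (2 / 2 ^ n))))) := measureReal_mono hsub (measure_ne_top _ _)
    _ ≤ ∑ n ∈ Finset.range (⌊y⌋₊ + 1),
        P.real (S (√y * (2 / 2 ^ n)) ∪ S (-(√y * (2 / 2 ^ n)))) :=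
        measureReal_biUnion_finset_le _ _
    _ ≤ ∑ n ∈ Finset.range (⌊y⌋₊ + 1), 2 * (1 - γ) := Finset.sum_le_sum fun n _ =>
        (measureReal_union_le _ _).trans (by
          linarith [hb (√y * (2 / 2 ^ n)), hb (-(√y * (2 / 2 ^ n)))])
    _ = (⌊y⌋₊ + 1) * (2 * (1 - γ)) := by simp
    _ ≤ _ := by nlinarith [Nat.floor_le hy0]

end Concentration

/-! ### Confidence bounds away from the breakpoints -/

/-- Only weights at least D rounds old survive; they carry the factor γ^D in front of a geometric
series. -/
lemma abs_dsum_le_of_eq_zero {γ : ℝ} (hγ : 0 ≤ γ) (hγ1 : γ < 1) {w : ℕ → ℝ} {t D : ℕ}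
    (hD : D ≤ t) (hw : ∀ s ∈ Finset.Icc 1 t, |w s| ≤ 1) (h0 : ∀ s, t - D < s → s ≤ t → w s = 0) :
    |dsum γ w t| ≤ γ ^ D * (1 / (1 - γ)) := by
  have h1 := dsum_add_time γ w (t - D) D
  have h2 : dsum γ (fun s => w (t - D + s)) D = dsum γ (fun _ => 0) D :=
    dsum_congr fun s hs => by
      have hs' := Finset.mem_Icc.1 hs
      exact h0 _ (by omega) (by omega)
  have h3 : dsum γ (fun _ => 0) D = 0 := by simp [dsum]
  rw [h2, h3, add_zero, show t - D + D = t by omega] at h1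
  rw [h1, abs_mul, abs_of_nonneg (pow_nonneg hγ D)]
  refine mul_le_mul_of_nonneg_left ?_ (pow_nonneg hγ D)
  have hsub : ∀ s ∈ Finset.Icc 1 (t - D), |w s| ≤ 1 := fun s hs => hw s (by
    rw [Finset.mem_Icc] at hs ⊢; omega)
  rw [abs_le]
  constructor
  · have := dsum_le_inv hγ hγ1 (w := fun s => -1 * w s) (t := t - D) fun s hs => by
      linarith [(abs_le.1 (hsub s hs)).1]
    rw [dsum_const_mul] at this
    linarith
  · exact dsum_le_inv hγ hγ1 fun s hs => (abs_le.1 (hsub s hs)).2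

/-- The total count is at least half its limit 1 / (1 - γ); the loss log 2 < 0.7 is a tenth of the
logarithm once that is at least 7. -/
lemma log_le_log_discTotal {K : ℕ} {γ : ℝ} (hγ1 : γ < 1) (A : ℕ → Fin K) {t : ℕ}
    (ht : γ ^ t ≤ 1 / 2) (hL : 7 ≤ Real.log (1 / (1 - γ))) :
    9 / 10 * Real.log (1 / (1 - γ)) ≤ Real.log (discTotal γ A t) := by
  have h1 : (1 / (1 - γ)) / 2 ≤ discTotal γ A t := by
    rw [discTotal_eq_dsum, div_div, div_le_iff₀ (by linarith)]
    have := dsum_one γ t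
    nlinarith
  have h2 : 0 < 1 / (1 - γ) := one_div_pos.2 (by linarith)
  have h3 := Real.log_le_log (by positivity) h1
  rw [Real.log_div h2.ne' two_ne_zero] at h3
  linarith [Real.log_two_lt_d9]

/-- Multiple of `log (1 / (1 - γ))` which the discounted count of an arm has to reach for its upper
confidence bound to be accurate up to `Δ`. -/
def gapConst (K : ℕ) (ξ : ℝ) (l : NNReal) (Δ : ℝ) : ℝ :=
  (1 + (2 + 3 / 2 * driftConst K ξ l + (6 * l + 2) * √ξ) / Δ) ^ 2

section Confidence

variable {K T : ℕ} {γ ξ : ℝ} {l : NNReal} {f : ℕ → ℝ → ℝ} {x : ℕ → Fin K → ℝ} {A g : ℕ → Fin K}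
  {χ r : ℕ → ℝ} {μ : ℕ → Fin K → ℝ}

/-- Bias plus noise: rewards from before the last D rounds may have other means, but their total
weight is at most γ^D / (1 - γ) ≤ 1 - γ. -/
lemma abs_dsum_sub_le (hγ : 0 < γ) (hγ1 : γ < 1) {t D : ℕ} (hD : D ≤ t)
    (hγD : γ ^ D ≤ (1 - γ) ^ 2) {a : Fin K} {m : ℝ} (hm : m ∈ Set.Icc (0 : ℝ) 1)
    (hμ : ∀ s ∈ Finset.Icc 1 t, μ s a ∈ Set.Icc (0 : ℝ) 1)
    (hconst : ∀ s, t - D < s → s ≤ t → μ s a = m)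
    (hZ : |dsum γ (fun s => pullInd A a s * (x s a - μ s a)) t|
      ≤ √(Real.log (1 / (1 - γ)) * discCount γ A t a)) :
    |dsum γ (fun s => pullInd A a s * x s a) t - m * discCount γ A t a|
      ≤ (1 - γ) + √(Real.log (1 / (1 - γ)) * discCount γ A t a) := by
  have h1 : |dsum γ (fun s => pullInd A a s * (μ s a - m)) t| ≤ 1 - γ := by
    refine (abs_dsum_le_of_eq_zero hγ.le hγ1 hD (fun s hs => ?_) fun s hs1 hs2 => ?_).trans ?_
    · rw [abs_mul, abs_of_nonneg (pullInd_nonneg A a s)]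
      refine mul_le_one₀ (pullInd_le_one A a s) (abs_nonneg _) ?_
      rw [abs_le]
      obtain ⟨h1, h2⟩ := hμ s hs
      constructor <;> linarith [hm.1, hm.2]
    · rw [hconst s hs1 hs2, sub_self, mul_zero]
    · have : (0 : ℝ) < 1 - γ := by linarith
      calc γ ^ D * (1 / (1 - γ)) ≤ (1 - γ) ^ 2 * (1 / (1 - γ)) := by gcongr
        _ = 1 - γ := by field_simp
  have h2 : dsum γ (fun s => pullInd A a s * x s a) t - m * discCount γ A t a
      = dsum γ (fun s => pullInd A a s * (μ s a - m)) t
        + dsum γ (fun s => pullInd A a s * (x s a - μ s a)) t := by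
    rw [discCount_eq_dsum, ← dsum_const_mul, ← dsum_sub, ← dsum_add]
    exact dsum_congr fun s _ => by ring
  rw [h2]
  exact (abs_add_le _ _).trans (add_le_add h1 hZ)

/-- The upper confidence bound of an arm is at least its expected reward. -/
lemma IsIncentivizedDUCB.le_ucb (h : IsIncentivizedDUCB T γ ξ f x A g χ r)
    (hf : IsDrift T l f) (hγ : 0 < γ) (hγ1 : γ < 1) (hξ : 1 / 2 < ξ)
    (hx : ∀ t ∈ Finset.Icc 1 T, ∀ a, x t a ∈ Set.Icc (0 : ℝ) 1)
    (hL : 7 ≤ Real.log (1 / (1 - γ))) (hε : 1 - γ ≤ 1 / 4) {t D : ℕ} (ht : t < T) (hK : K ≤ t)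
    (hD : D ≤ t) (hγD : γ ^ D ≤ (1 - γ) ^ 2) {b : Fin K}
    (hμ : ∀ s ∈ Finset.Icc 1 T, μ s b ∈ Set.Icc (0 : ℝ) 1)
    (hconst : ∀ s, t - D < s → s ≤ t → μ s b = μ (t + 1) b)
    (hZ : 1 ≤ discCount γ A t b → |dsum γ (fun s => pullInd A b s * (x s b - μ s b)) t|
      ≤ √(Real.log (1 / (1 - γ)) * discCount γ A t b)) :
    μ (t + 1) b ≤ ucb γ ξ A r t b := by
  set Λ := Real.log (1 / (1 - γ))
  set N := discCount γ A t b with hN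
  have hN0 : 0 < N := h.discCount_pos hγ ht.le hK b
  have hm := hμ (t + 1) (Finset.mem_Icc.2 ⟨by omega, ht⟩)
  have hγt : γ ^ t ≤ 1 / 2 :=
    (pow_le_pow_of_le_one hγ.le hγ1.le hD).trans (hγD.trans (by nlinarith))
  have hlog := log_le_log_discTotal hγ1 A hγt hL
  have hξL : 9 / 20 * Λ ≤ ξ * Real.log (discTotal γ A t) := by nlinarith
  have hc0 : 2 * √(9 / 20 * Λ / N) ≤ confRadius γ ξ A t b := by
    unfold confRadius
    gcongr
  unfold ucb
  rcases lt_or_ge N 1 with h1 | h1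
  -- At counts below 1 the radius alone exceeds every possible mean, so no concentration is needed.
  · have h2 : 1 ≤ √(9 / 20 * Λ / N) := by
      rw [Real.one_le_sqrt, le_div_iff₀ hN0]; linarith
    linarith [h.discMean_nonneg hf hγ.le hx ht.le b, hm.2]
  · have h2 := abs_dsum_sub_le hγ hγ1 hD hγD hm
      (fun s hs => hμ s (by rw [Finset.mem_Icc] at hs ⊢; omega)) hconst (hZ h1)
    have h3 := h.le_discMean_mul hf hγ ht.le b
    rw [← hN] at h2 h3
    -- Here ξ > 1/2 pays off: 2√(9/20) > 5/4 leaves √(ΛN)/4 to absorb the bias 1 - γ ≤ 1/4.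
    have h4 : 5 / 4 * √(Λ * N) ≤ 2 * √(9 / 20 * Λ / N) * N := by
      have e : √(9 / 20 * Λ / N) * N = √(9 / 20 * (Λ * N)) := by
        have : 9 / 20 * (Λ * N) = 9 / 20 * Λ / N * N ^ 2 := by field_simp
        rw [this, Real.sqrt_mul (by positivity), Real.sqrt_sq hN0.le]
      rw [mul_assoc, e]
      have e2 : 5 / 8 * √(Λ * N) ≤ √(9 / 20 * (Λ * N)) := by
        refine Real.le_sqrt_of_sq_le ?_
        rw [mul_pow, Real.sq_sqrt (by positivity)]
        have : 0 ≤ Λ * N := by positivity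
        linarith
      linarith
    have h5 : 1 ≤ √(Λ * N) := by
      rw [Real.one_le_sqrt]; nlinarith
    have h6 := mul_le_mul_of_nonneg_right hc0 hN0.le
    have h7 := (abs_le.1 h2).1
    refine le_of_mul_le_mul_right ?_ hN0
    rw [add_mul]
    linarith

/-- The upper confidence bound of a sufficiently explored arm exceeds its expected reward by less
than `Δ`. -/
lemma IsIncentivizedDUCB.ucb_lt (h : IsIncentivizedDUCB T γ ξ f x A g χ r)
    (hf : IsDrift T l f) (hγ : 0 < γ) (hγ1 : γ < 1) (hξ : 0 ≤ ξ)
    (hx : ∀ t ∈ Finset.Icc 1 T, ∀ a, x t a ∈ Set.Icc (0 : ℝ) 1)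
    (hW : 1 / 2 ≤ γ ^ windowLength K l) (hL : 7 ≤ Real.log (1 / (1 - γ))) {t D : ℕ}
    (ht : t < T) (hD : D ≤ t) (hγD : γ ^ D ≤ (1 - γ) ^ 2) {a : Fin K}
    (hμ : ∀ s ∈ Finset.Icc 1 T, μ s a ∈ Set.Icc (0 : ℝ) 1)
    (hconst : ∀ s, t - D < s → s ≤ t → μ s a = μ (t + 1) a)
    (hZ : 1 ≤ discCount γ A t a → |dsum γ (fun s => pullInd A a s * (x s a - μ s a)) t|
      ≤ √(Real.log (1 / (1 - γ)) * discCount γ A t a)) {Δ : ℝ} (hΔ : 0 < Δ)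
    (hNa : gapConst K ξ l Δ * Real.log (1 / (1 - γ)) ≤ discCount γ A t a) :
    ucb γ ξ A r t a < μ (t + 1) a + Δ := by
  have hdrift := h.drift_le hf hγ hγ1 hξ hx hW (by linarith)
  set Λ := Real.log (1 / (1 - γ)) with hΛ
  set N := discCount γ A t a with hN
  set C := driftConst K ξ l with hC
  have hC0 : 0 ≤ C := driftConst_nonneg K ξ l
  set B := 2 + 3 / 2 * C + (6 * l + 2) * √ξ with hB
  have hB0 : 0 < B := by positivity
  set q := 1 + B / Δ with hq
  have hq1 : 1 ≤ q := by
    have : 0 < B / Δ := by positivity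
    linarith
  have hBq : B < Δ * q := by
    have : Δ * q = Δ + B := by rw [hq]; field_simp
    linarith
  have hqN : q ^ 2 * Λ ≤ N := hNa
  have hN1 : 1 ≤ N := by nlinarith
  have hN0 : 0 < N := by linarith
  have hm := hμ (t + 1) (Finset.mem_Icc.2 ⟨by omega, ht⟩)
  have h2 := abs_dsum_sub_le hγ hγ1 hD hγD hm
    (fun s hs => hμ s (by rw [Finset.mem_Icc] at hs ⊢; omega)) hconst (hZ hN1)
  rw [← hN, ← hΛ] at h2
  have h3 := h.discMean_mul_le hf hγ hγ1 hξ (R := C * Λ) (by positivity) ht.le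
    (fun s hs => hdrift s (by omega)) a
  rw [← hN, ← hΛ] at h3
  have h4 : confRadius γ ξ A t a * N ≤ 2 * √ξ * √(Λ * N) := by
    have e1 := confRadius_le hγ hγ1 hξ A t a hN0 le_rfl
    rw [← hΛ] at e1
    have e2 := mul_le_mul_of_nonneg_right e1 hN0.le
    have e3 : √(ξ * Λ / N) * N = √ξ * √(Λ * N) := by
      rw [← Real.sqrt_mul hξ]
      have : ξ * (Λ * N) = ξ * Λ / N * N ^ 2 := by field_simp
      rw [this, Real.sqrt_mul (by positivity), Real.sqrt_sq hN0.le]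
    rw [mul_assoc, e3] at e2
    linarith
  have h5 : √(ξ * Λ) * √N = √ξ * √(Λ * N) := by
    rw [Real.sqrt_mul hξ, Real.sqrt_mul (by linarith), mul_assoc]
  have h6 : q * √(Λ * N) ≤ N := by
    have e : (q * √(Λ * N)) ^ 2 ≤ N ^ 2 := by
      rw [mul_pow, Real.sq_sqrt (by positivity)]
      nlinarith
    exact le_of_sq_le_sq e hN0.le
  have h7 : q * Λ ≤ N := by nlinarith
  have h8 : q ≤ N := by nlinarith
  have h9 := (abs_le.1 h2).2
  unfold ucb
  -- Each error term, multiplied by q, is at most a constant times N; the constants add up to B, and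
  -- B < Δq.
  refine lt_of_mul_lt_mul_right (a := q * N) ?_ (by positivity)
  have h10 : (discMean γ A r t a + confRadius γ ξ A t a) * N ≤ μ (t + 1) a * N + 1 + √(Λ * N)
      + (6 * l + 2) * √ξ * √(Λ * N) + 3 / 2 * C * Λ := by
    have e : 6 * (l : ℝ) * √(ξ * Λ) * √N = 6 * l * (√ξ * √(Λ * N)) := by
      rw [mul_assoc, h5]
    rw [e] at h3
    linarith
  have h11 : q * (1 + √(Λ * N) + (6 * l + 2) * √ξ * √(Λ * N) + 3 / 2 * C * Λ) ≤ B * N := by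
    have e1 := mul_le_mul_of_nonneg_left h6 (show 0 ≤ (6 * (l : ℝ) + 2) * √ξ by positivity)
    have e2 := mul_le_mul_of_nonneg_left h7 (show 0 ≤ 3 / 2 * C by positivity)
    rw [hB]
    linarith
  have h12 := mul_lt_mul_of_pos_right hBq hN0
  have h13 := mul_le_mul_of_nonneg_left h10 (show 0 ≤ q by linarith)
  linarith

end Confidence

/-! ### Expected number of suboptimal pulls -/

lemma sum_Icc_one_eq_sum_range (w : ℕ → ℝ) (T : ℕ) :
    ∑ t ∈ Finset.Icc 1 T, w t = ∑ t ∈ Finset.range T, w (t + 1) := by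
  induction T with
  | zero => simp
  | succ T ih => rw [Finset.sum_Icc_succ_top (by omega), ih, Finset.sum_range_succ]

/-- Number of rounds after which all earlier information is discounted away. -/
def memoryLength (γ : ℝ) : ℕ := ⌈2 * Real.log (1 / (1 - γ)) / (1 - γ)⌉₊

lemma pow_memoryLength_le {γ : ℝ} (hγ : 0 < γ) (hγ1 : γ < 1) :
    γ ^ memoryLength γ ≤ (1 - γ) ^ 2 := by
  have hε : 0 < 1 - γ := by linarith
  have h1 : γ ≤ Real.exp (-(1 - γ)) := by linarith [Real.add_one_le_exp (-(1 - γ))]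
  have h2 : 2 * Real.log (1 / (1 - γ)) ≤ memoryLength γ * (1 - γ) := by
    rw [← div_le_iff₀ hε]; exact Nat.le_ceil _
  calc γ ^ memoryLength γ ≤ Real.exp (-(1 - γ)) ^ memoryLength γ :=
        pow_le_pow_left₀ hγ.le h1 _
    _ = Real.exp (memoryLength γ * (-(1 - γ))) := by rw [Real.exp_nat_mul]
    _ ≤ Real.exp (2 * Real.log (1 - γ)) := by
        rw [one_div, Real.log_inv] at h2
        exact Real.exp_le_exp.2 (by linarith)
    _ = (1 - γ) ^ 2 := by
        rw [two_mul, Real.exp_add, Real.exp_log hε, sq]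

section Expectation

variable {Ω : Type*} [mΩ : MeasurableSpace Ω] {K T : ℕ} {P : Measure Ω}
  {ℱ : Filtration ℕ mΩ} {X : ℕ → Fin K → Ω → ℝ} {A g : ℕ → Ω → Fin K} {γ ξ : ℝ} {l : NNReal}
  {f : ℕ → ℝ → ℝ} {χ r : ℕ → Ω → ℝ}

lemma meanReward_congr (hX : IsRewardProcess T P ℱ X) {s t : ℕ} (hs : s ∈ Finset.Icc 1 T)
    (ht : t ∈ Finset.Icc 1 T) {a : Fin K} (h : P.map (X s a) = P.map (X t a)) :
    meanReward P X s a = meanReward P X t a := by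
  have hm : ∀ u ∈ Finset.Icc 1 T, meanReward P X u a = ∫ y, y ∂(P.map (X u a)) := fun u hu => by
    have hmeas : Measurable (X u a) := (hX.measurable u hu a).mono (ℱ.le u) le_rfl
    exact (integral_map (f := fun y : ℝ => y) hmeas.aemeasurable
      measurable_id.aestronglyMeasurable).symm
  rw [hm s hs, hm t ht, h]

open Classical in
/-- The breakpoints within the horizon `T`. -/
def breakpoints (T : ℕ) (P : Measure Ω) (X : ℕ → Fin K → Ω → ℝ) : Finset ℕ :=
  (Finset.Ico 1 T).filter fun t => ∃ a, P.map (X t a) ≠ P.map (X (t + 1) a)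

lemma card_breakpoints (T : ℕ) (P : Measure Ω) (X : ℕ → Fin K → Ω → ℝ) :
    (breakpoints T P X).card = numBreakpoints T P X := rfl

/-- Rounds (shifted by one) that follow a breakpoint closely. -/
def afterBreakpoint (T : ℕ) (P : Measure Ω) (X : ℕ → Fin K → Ω → ℝ) (D : ℕ) : Finset ℕ :=
  (breakpoints T P X).biUnion fun i => Finset.Ico i (i + D)

lemma card_afterBreakpoint_le (T : ℕ) (P : Measure Ω) (X : ℕ → Fin K → Ω → ℝ) (D : ℕ) :
    (afterBreakpoint T P X D).card ≤ numBreakpoints T P X * D := by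
  rw [← card_breakpoints]
  exact Finset.card_biUnion_le_card_mul _ _ _ fun i _ => by simp

-- Outside the set no breakpoint lies in (t - D, t], so the laws can be chained from round s to
-- round t + 1.
open Classical in
lemma meanReward_eq_of_notMem_afterBreakpoint (hX : IsRewardProcess T P ℱ X) {t D : ℕ}
    (ht : t < T) (h : t ∉ afterBreakpoint T P X D) (a : Fin K) {s : ℕ} (hs0 : 1 ≤ s)
    (hs1 : t - D < s) (hs2 : s ≤ t) : meanReward P X s a = meanReward P X (t + 1) a := by
  refine meanReward_congr hX (Finset.mem_Icc.2 ⟨hs0, by omega⟩)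
    (Finset.mem_Icc.2 ⟨by omega, by omega⟩) ?_
  have key : ∀ i, 1 ≤ i → t - D < i → i ≤ t → P.map (X i a) = P.map (X (i + 1) a) := by
    intro i h1 h2 h3
    by_contra hne
    refine h (Finset.mem_biUnion.2 ⟨i, Finset.mem_filter.2 ⟨Finset.mem_Ico.2 ⟨h1, by omega⟩,
      a, hne⟩, Finset.mem_Ico.2 ⟨h3, by omega⟩⟩)
  obtain ⟨n, rfl⟩ : ∃ n, t = s + n := ⟨t - s, by omega⟩
  have : ∀ m ≤ n, P.map (X s a) = P.map (X (s + m + 1) a) := by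
    intro m
    induction m with
    | zero => intro _; exact key s hs0 hs1 (by omega)
    | succ m ih =>
      intro hm
      rw [ih (by omega), add_assoc s m 1]
      exact key (s + (m + 1)) (by omega) (by omega) (by omega)
  exact this n le_rfl

variable [IsProbabilityMeasure P]

lemma meanReward_mem (hX : IsRewardProcess T P ℱ X) {t : ℕ} (ht : t ∈ Finset.Icc 1 T)
    (a : Fin K) : meanReward P X t a ∈ Set.Icc (0 : ℝ) 1 := by
  have hm : Measurable (X t a) := (hX.measurable t ht a).mono (ℱ.le t) le_rfl
  have hi : Integrable (X t a) P := Integrable.of_mem_Icc 0 1 hm.aemeasurable (hX.mem_unit t ht a)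
  constructor
  · exact integral_nonneg_of_ae ((hX.mem_unit t ht a).mono fun ω h => h.1)
  · have := integral_mono_ae hi (integrable_const 1) ((hX.mem_unit t ht a).mono fun ω h => h.2)
    simpa [meanReward] using this

/-- Event that the rewards of arm `a` deviate from their expectations by more than the confidence
level allows. -/
def deviationEvent (γ : ℝ) (P : Measure Ω) (X : ℕ → Fin K → Ω → ℝ) (A : ℕ → Ω → Fin K) (t : ℕ)
    (a : Fin K) : Set Ω :=
  {ω | 1 ≤ discCount γ (fun s => A s ω) t a ∧
    √(Real.log (1 / (1 - γ)) * discCount γ (fun s => A s ω) t a) < |discNoise γ P X A t a ω|}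

/-- Expected number of suboptimal pulls when the discount factor is close to `1`. -/
theorem integral_suboptimalPulls_le (hX : IsRewardProcess T P ℱ X) (hf : IsDrift T l f)
    (hA : ∀ t < T, Measurable[ℱ t] (A (t + 1)))
    (h : ∀ ω, IsIncentivizedDUCB T γ ξ f (fun t a => X t a ω) (fun t => A t ω) (fun t => g t ω)
      (fun t => χ t ω) (fun t => r t ω))
    (hγ : 0 < γ) (hγ1 : γ < 1) (hξ : 1 / 2 < ξ)
    (hW : 1 / 2 ≤ γ ^ windowLength K l) (hL : 7 ≤ Real.log (1 / (1 - γ))) (hε : 1 - γ ≤ 1 / 4)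
    {Δ : ℝ} (hΔ : 0 < Δ) {a : Fin K} (hgap : GapAtLeast T P X Δ a) :
    ∫ ω, suboptimalPulls T P X A a ω ∂P ≤ (K + memoryLength γ)
      + numBreakpoints T P X * memoryLength γ
      + (gapConst K ξ l Δ * Real.log (1 / (1 - γ)) + 1) * (1 + (1 - γ) * T)
      + 4 * (Real.log (1 / (1 - γ)) + 1) * (1 - γ) * T := by
  classical
  set Λ := Real.log (1 / (1 - γ)) with hΛ
  set D := memoryLength γ with hD
  set c0 := gapConst K ξ l Δ * Λ with hc0
  have hc00 : 0 ≤ c0 := mul_nonneg (sq_nonneg _) (by linarith)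
  have hγD : γ ^ D ≤ (1 - γ) ^ 2 := pow_memoryLength_le hγ hγ1
  have : Nonempty (Fin K) := ⟨a⟩
  have hbest : ∀ t, ∃ b, meanReward P X t b = bestReward P X t := fun t =>
    exists_eq_ciSup_of_finite
  choose b hb using hbest
  -- Measurable hulls have the same probability and can be integrated without proving the events
  -- measurable.
  set E : ℕ → Fin K → Set Ω := fun t a => toMeasurable P (deviationEvent γ P X A t a) with hE
  have hEm : ∀ t a, MeasurableSet (E t a) := fun t a => measurableSet_toMeasurable _ _
  have hEP : ∀ t < T, ∀ a, P.real (E t a) ≤ 2 * (Λ + 1) * (1 - γ) := fun t ht a => by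
    simp only [hE, Measure.real, measure_toMeasurable]
    exact measureReal_abs_discNoise_gt_le hX hA hγ hγ1 a ht.le hΛ
  have hx : ∀ᵐ ω ∂P, ∀ t ∈ Finset.Icc 1 T, ∀ a, X t a ω ∈ Set.Icc (0 : ℝ) 1 := by
    rw [ae_all_iff]; intro t
    rw [ae_all_iff]; intro ht
    rw [ae_all_iff]; exact hX.mem_unit t ht
  have hterm : ∀ ω, (∀ t ∈ Finset.Icc 1 T, ∀ a, X t a ω ∈ Set.Icc (0 : ℝ) 1) → ∀ t < T,
      (if A (t + 1) ω = a ∧ meanReward P X (t + 1) a < bestReward P X (t + 1) then (1 : ℝ) else 0)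
      ≤ (if t ∈ Finset.range (K + D) then 1 else 0)
        + (if t ∈ afterBreakpoint T P X D then 1 else 0)
        + (if A (t + 1) ω = a ∧ discCount γ (fun s => A s ω) t a < c0 then 1 else 0)
        + ((E t a).indicator 1 ω + (E t (b (t + 1))).indicator 1 ω) := by
    intro ω hxω t ht
    have hi : ∀ a, (0 : ℝ) ≤ (E t a).indicator 1 ω := fun a =>
      Set.indicator_nonneg (fun _ _ => zero_le_one) ω
    have hi1 := hi a
    have hi2 := hi (b (t + 1))
    by_cases h1 : A (t + 1) ω = a ∧ meanReward P X (t + 1) a < bestReward P X (t + 1)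
    · by_cases h2 : t ∈ Finset.range (K + D)
      · rw [if_pos h1, if_pos h2]
        have : ∀ (p q : Prop) [Decidable p] [Decidable q],
            (0 : ℝ) ≤ (if p then 1 else 0) + if q then 1 else 0 := fun p q _ _ => by positivity
        linarith [this (t ∈ afterBreakpoint T P X D)
          (A (t + 1) ω = a ∧ discCount γ (fun s => A s ω) t a < c0)]
      by_cases h3 : t ∈ afterBreakpoint T P X D
      · rw [if_pos h1, if_neg h2, if_pos h3]
        have : (0 : ℝ) ≤ if A (t + 1) ω = a ∧ discCount γ (fun s => A s ω) t a < c0 then 1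
          else 0 := by positivity
        linarith
      by_cases h4 : discCount γ (fun s => A s ω) t a < c0
      · rw [if_pos h1, if_neg h2, if_neg h3, if_pos ⟨h1.1, h4⟩]
        linarith
      rw [if_pos h1, if_neg h2, if_neg h3, if_neg (fun hh => h4 hh.2)]
      -- In the remaining case both noises are under control, and the chain of inequalities between
      -- the two upper confidence bounds is contradictory.
      by_contra! hlt
      have hnot : ∀ a, (E t a).indicator (1 : Ω → ℝ) ω < 1 → ω ∉ deviationEvent γ P X A t a := by
        intro a hlt hmem
        rw [Set.indicator_of_mem (subset_toMeasurable _ _ hmem)] at hlt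
        simp at hlt
      have hn1 := hnot a (by linarith)
      have hn2 := hnot (b (t + 1)) (by linarith)
      have hnoise : ∀ a, ω ∉ deviationEvent γ P X A t a →
          1 ≤ discCount γ (fun s => A s ω) t a →
          |dsum γ (fun s => pullInd (fun s => A s ω) a s * (X s a ω - meanReward P X s a)) t|
            ≤ √(Λ * discCount γ (fun s => A s ω) t a) := by
        intro a hna h1
        by_contra! hc
        exact hna ⟨h1, hc⟩
      rw [Finset.mem_range, not_lt] at h2
      have hconst : ∀ a, ∀ s, t - D < s → s ≤ t →
          meanReward P X s a = meanReward P X (t + 1) a := fun a s hs1 hs2 =>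
        meanReward_eq_of_notMem_afterBreakpoint hX ht h3 a (by omega) hs1 hs2
      have e1 := (h ω).le_ucb hf hγ hγ1 hξ hxω hL hε (μ := meanReward P X) ht (by omega)
        (D := D) (by omega) hγD (fun s hs => meanReward_mem hX hs _)
        (hconst (b (t + 1))) (hnoise _ hn2)
      have e2 := (h ω).ucb_lt hf hγ hγ1 (by linarith) hxω hW hL (μ := meanReward P X) ht
        (D := D) (by omega) hγD (fun s hs => meanReward_mem hX hs _)
        (hconst a) (hnoise _ hn1) hΔ (not_lt.1 h4)
      have e3 := (h ω).recommend t ht (by omega) (b (t + 1))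
      have e4 := hgap (t + 1) (Finset.mem_Icc.2 ⟨by omega, ht⟩) h1.2
      rw [h1.1] at e3
      rw [hb] at e1
      linarith
    · rw [if_neg h1]
      positivity
  have hpoint : ∀ᵐ ω ∂P, suboptimalPulls T P X A a ω ≤ ((K + D)
      + numBreakpoints T P X * D + (c0 + 1) * (1 + (1 - γ) * T))
      + ∑ t ∈ Finset.range T, ((E t a).indicator 1 ω + (E t (b (t + 1))).indicator 1 ω) := by
    filter_upwards [hx] with ω hxω
    unfold suboptimalPulls
    rw [sum_Icc_one_eq_sum_range]
    have hsum := Finset.sum_le_sum fun t ht => hterm ω hxω t (Finset.mem_range.1 ht)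
    rw [Finset.sum_add_distrib, Finset.sum_add_distrib, Finset.sum_add_distrib] at hsum
    have hcard : ∀ S : Finset ℕ,
        ∑ t ∈ Finset.range T, (if t ∈ S then (1 : ℝ) else 0) ≤ S.card := fun S => by
      rw [Finset.sum_boole]
      exact_mod_cast Finset.card_le_card fun i hi => (Finset.mem_filter.1 hi).2
    have h1 := hcard (Finset.range (K + D))
    have h2 := hcard (afterBreakpoint T P X D)
    rw [Finset.card_range] at h1
    push_cast at h1
    have h3 : ((afterBreakpoint T P X D).card : ℝ) ≤ numBreakpoints T P X * D := by
      exact_mod_cast card_afterBreakpoint_le T P X D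
    have h4 := sum_low_le hγ.le hγ1.le (fun s => A s ω) a hc00 T
    refine le_trans (le_of_eq ?_) (hsum.trans ?_)
    · exact Finset.sum_congr rfl fun t _ => by congr
    · linarith
  have hint : ∀ t a, Integrable ((E t a).indicator (1 : Ω → ℝ)) P := fun t a =>
    (integrable_const (1 : ℝ)).indicator (hEm t a)
  have hint2 : ∀ t ∈ Finset.range T, Integrable (fun ω => (E t a).indicator (1 : Ω → ℝ) ω
      + (E t (b (t + 1))).indicator (1 : Ω → ℝ) ω) P := fun t _ => (hint _ _).add (hint _ _)
  have hnn : 0 ≤ᵐ[P] fun ω => suboptimalPulls T P X A a ω := by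
    refine Filter.Eventually.of_forall fun ω => Finset.sum_nonneg fun t _ => ?_
    split_ifs <;> norm_num
  refine (integral_mono_of_nonneg hnn ((integrable_const _).add (integrable_finsetSum _ hint2))
    hpoint).trans ?_
  simp only [Pi.add_apply]
  rw [integral_add (integrable_const _) (integrable_finsetSum _ hint2),
    integral_finsetSum _ hint2]
  have hlast : ∑ t ∈ Finset.range T, ∫ ω, ((E t a).indicator (1 : Ω → ℝ) ω
      + (E t (b (t + 1))).indicator (1 : Ω → ℝ) ω) ∂P
      ≤ ∑ t ∈ Finset.range T, 4 * (Λ + 1) * (1 - γ) := by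
    refine Finset.sum_le_sum fun t ht => ?_
    rw [integral_add (hint _ _) (hint _ _), integral_indicator_one (hEm _ _),
      integral_indicator_one (hEm _ _)]
    linarith [hEP t (Finset.mem_range.1 ht) a, hEP t (Finset.mem_range.1 ht) (b (t + 1))]
  simp only [Finset.sum_const, Finset.card_range, nsmul_eq_mul] at hlast
  rw [integral_const]
  simp only [probReal_univ, one_smul]
  linarith

/-- The regret is controlled by the numbers of suboptimal pulls. -/
theorem integral_regret_le (hX : IsRewardProcess T P ℱ X)
    (hA : ∀ t < T, Measurable[ℱ t] (A (t + 1))) :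
    ∫ ω, regret T P X A ω ∂P ≤ ∑ a, ∫ ω, suboptimalPulls T P X A a ω ∂P := by
  classical
  have hind : ∀ t, t ∈ Finset.Icc 1 T → ∀ a,
      Measurable fun ω => pullInd (fun s => A s ω) a t := fun t ht a => by
    have ht' := Finset.mem_Icc.1 ht
    exact (measurable_pullInd hA ht'.1 ht'.2 (k := T) (by omega) a).mono (ℱ.le T) le_rfl
  have hindI : ∀ t, t ∈ Finset.Icc 1 T → ∀ a,
      Integrable (fun ω => pullInd (fun s => A s ω) a t) P := fun t ht a =>
    Integrable.of_mem_Icc 0 1 (hind t ht a).aemeasurable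
      (Filter.Eventually.of_forall fun ω => ⟨pullInd_nonneg _ _ _, pullInd_le_one _ _ _⟩)
  have hXm : ∀ t ∈ Finset.Icc 1 T, ∀ a, Measurable (X t a) := fun t ht a =>
    (hX.measurable t ht a).mono (ℱ.le t) le_rfl
  have hprodI : ∀ t, t ∈ Finset.Icc 1 T → ∀ a,
      Integrable (fun ω => pullInd (fun s => A s ω) a t * X t a ω) P := fun t ht a => by
    refine Integrable.of_mem_Icc 0 1 ((hind t ht a).mul (hXm t ht a)).aemeasurable ?_
    filter_upwards [hX.mem_unit t ht a] with ω hω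
    exact ⟨mul_nonneg (pullInd_nonneg _ _ _) hω.1,
      mul_le_one₀ (pullInd_le_one _ _ _) hω.1 hω.2⟩
  -- The choice of arm is independent of the current rewards, so in expectation a reward may be
  -- replaced by its mean.
  have hprod : ∀ t, t ∈ Finset.Icc 1 T → ∀ a,
      ∫ ω, pullInd (fun s => A s ω) a t * X t a ω ∂P
        = (∫ ω, pullInd (fun s => A s ω) a t ∂P) * meanReward P X t a := fun t ht a => by
    have ht' := Finset.mem_Icc.1 ht
    obtain ⟨u, rfl⟩ : ∃ u, t = u + 1 := ⟨t - 1, by omega⟩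
    have hi : IndepFun (fun ω => pullInd (fun s => A s ω) a (u + 1)) (X (u + 1) a) P := by
      rw [IndepFun_iff_Indep]
      refine indep_of_indep_of_le_left (indep_of_indep_of_le_right
        (hX.indep u (by omega)).symm ?_) ?_
      · exact le_iSup (fun b => MeasurableSpace.comap (X (u + 1) b) inferInstance) a
      · exact (measurable_pullInd hA ht'.1 ht'.2 (k := u) le_rfl a).comap_le
    exact hi.integral_fun_mul_eq_mul_integral (hind _ ht a).aestronglyMeasurable
      (hXm _ ht a).aestronglyMeasurable
  have hreg : ∀ ω, regret T P X A ω = ∑ t ∈ Finset.Icc 1 T, ∑ a,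
      (pullInd (fun s => A s ω) a t * bestReward P X t
        - pullInd (fun s => A s ω) a t * X t a ω) := fun ω => by
    unfold regret
    refine Finset.sum_congr rfl fun t _ => ?_
    rw [Finset.sum_eq_single (A t ω)]
    · simp [pullInd]
    · intro c _ hc; simp [pullInd, hc.symm]
    · simp
  have hsub : ∀ a ω, suboptimalPulls T P X A a ω = ∑ t ∈ Finset.Icc 1 T,
      pullInd (fun s => A s ω) a t *
        (if meanReward P X t a < bestReward P X t then 1 else 0) := fun a ω => by
    unfold suboptimalPulls
    refine Finset.sum_congr rfl fun t _ => ?_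
    by_cases h1 : A t ω = a <;> by_cases h2 : meanReward P X t a < bestReward P X t <;>
      simp [pullInd, h1, h2]
  have hdiffI : ∀ t, t ∈ Finset.Icc 1 T → ∀ a, Integrable (fun ω =>
      pullInd (fun s => A s ω) a t * bestReward P X t
        - pullInd (fun s => A s ω) a t * X t a ω) P := fun t ht a =>
    ((hindI t ht a).mul_const _).sub (hprodI t ht a)
  simp_rw [hreg, hsub]
  rw [integral_finsetSum _ fun t ht => integrable_finsetSum _ fun a _ => hdiffI t ht a]
  have e1 : ∀ a, ∫ ω, ∑ t ∈ Finset.Icc 1 T, pullInd (fun s => A s ω) a t *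
        (if meanReward P X t a < bestReward P X t then 1 else 0) ∂P
      = ∑ t ∈ Finset.Icc 1 T, (∫ ω, pullInd (fun s => A s ω) a t ∂P) *
        (if meanReward P X t a < bestReward P X t then 1 else 0) := fun a => by
    rw [integral_finsetSum _ fun t ht => (hindI t ht a).mul_const _]
    exact Finset.sum_congr rfl fun t _ => integral_mul_const _ _
  simp_rw [e1]
  rw [Finset.sum_comm]
  refine Finset.sum_le_sum fun t ht => ?_
  rw [integral_finsetSum _ fun a _ => hdiffI t ht a]
  refine Finset.sum_le_sum fun a _ => ?_
  rw [integral_sub ((hindI t ht a).mul_const _) (hprodI t ht a), integral_mul_const,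
    hprod t ht a, ← mul_sub]
  refine mul_le_mul_of_nonneg_left ?_ (integral_nonneg fun ω => pullInd_nonneg _ _ _)
  have hle : meanReward P X t a ≤ bestReward P X t :=
    le_ciSup (Set.finite_range (meanReward P X t)).bddAbove a
  have : Nonempty (Fin K) := ⟨a⟩
  -- All gaps are at most 1, so a suboptimal pull costs at most one unit, and an optimal pull
  -- nothing.
  have hle1 : bestReward P X t ≤ 1 := ciSup_le fun b => (meanReward_mem hX ht b).2
  split_ifs with h1
  · linarith [(meanReward_mem hX ht a).1]
  · linarith

end Expectation

/-! ### Choice of the discount factor -/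

lemma numBreakpoints_lt {Ω : Type*} [MeasurableSpace Ω] {K T : ℕ} (P : Measure Ω)
    (X : ℕ → Fin K → Ω → ℝ) (h : 1 ≤ numBreakpoints T P X) : numBreakpoints T P X < T := by
  classical
  have h1 : numBreakpoints T P X ≤ (Finset.Ico 1 T).card := Finset.card_filter_le _ _
  rw [Nat.card_Ico] at h1
  omega

/-- Largest value of `1 - γ` for which the asymptotic analysis applies. -/
def discountGap (K : ℕ) (l : NNReal) : ℝ := min (1 / (2 * windowLength K l)) (Real.exp (-7))

lemma windowLength_pos (K : ℕ) (l : NNReal) : 0 < (windowLength K l : ℝ) := by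
  unfold windowLength; positivity

lemma discountGap_pos (K : ℕ) (l : NNReal) : 0 < discountGap K l :=
  lt_min (one_div_pos.2 (by linarith [windowLength_pos K l])) (Real.exp_pos _)

/-- Multiple of `log T` that bounds `log (1 / (1 - γ))`. -/
def logConst (η : ℝ) : ℝ := 1 + 2 * |Real.log η|

/-- The constant of the main theorem. -/
def pullConst (K : ℕ) (ξ : ℝ) (l : NNReal) (Δ η : ℝ) : ℝ :=
  2 * K + (4 * logConst η / η + 4) + (gapConst K ξ l Δ * logConst η + 2) * (1 + η)
    + 4 * η * (logConst η + 2) + 2 * (η / discountGap K l)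

lemma logConst_pos (η : ℝ) : 0 < logConst η := by unfold logConst; positivity

lemma gapConst_nonneg (K : ℕ) (ξ : ℝ) (l : NNReal) (Δ : ℝ) : 0 ≤ gapConst K ξ l Δ :=
  sq_nonneg _

lemma pullConst_pos (K : ℕ) (ξ : ℝ) (l : NNReal) (Δ : ℝ) {η : ℝ} (hη : 0 < η) :
    0 < pullConst K ξ l Δ η := by
  have h1 := logConst_pos η
  have h2 := gapConst_nonneg K ξ l Δ
  have h3 := discountGap_pos K l
  unfold pullConst
  positivity

-- With ε = 1 - γ and s = √(Tβ) one has εT = ηs and β/ε = s/η. Hence the forgetting cost βΛ/ε and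
-- the exploration and deviation costs ΛεT are all of order sΛ, and Λ = O(log T).
set_option maxHeartbeats 800000 in
lemma integral_suboptimalPulls_le_pullConst {Ω : Type*} [mΩ : MeasurableSpace Ω] {K T β : ℕ}
    {P : Measure Ω} [IsProbabilityMeasure P] {ℱ : Filtration ℕ mΩ} {X : ℕ → Fin K → Ω → ℝ}
    {A g : ℕ → Ω → Fin K} {γ ξ : ℝ} {l : NNReal} {f : ℕ → ℝ → ℝ} {χ r : ℕ → Ω → ℝ}
    (hX : IsRewardProcess T P ℱ X) (hf : IsDrift T l f)
    (hA : ∀ t < T, Measurable[ℱ t] (A (t + 1)))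
    (h : ∀ ω, IsIncentivizedDUCB T γ ξ f (fun t a => X t a ω) (fun t => A t ω) (fun t => g t ω)
      (fun t => χ t ω) (fun t => r t ω))
    (hξ : 1 / 2 < ξ) {η : ℝ} (hη : 0 < η) (hβ : β = numBreakpoints T P X) (hβ1 : 1 ≤ β)
    (hγη : γ = 1 - η * √((β : ℝ) / T)) (hγ : 0 < γ) {Δ : ℝ} (hΔ : 0 < Δ) {a : Fin K}
    (hgap : GapAtLeast T P X Δ a) :
    ∫ ω, suboptimalPulls T P X A a ω ∂P
      ≤ pullConst K ξ l Δ η * √((T : ℝ) * β) * Real.log T := by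
  have hβT : β < T := by rw [hβ] at hβ1 ⊢; exact numBreakpoints_lt P X hβ1
  have hβ1' : (1 : ℝ) ≤ β := by exact_mod_cast hβ1
  have hβT' : (β : ℝ) ≤ T := by exact_mod_cast hβT.le
  have hT2 : (2 : ℝ) ≤ T := by exact_mod_cast (by omega : 2 ≤ T)
  have hT0 : (0 : ℝ) < T := by linarith
  set L := Real.log T with hLdef
  have hL : 1 ≤ 2 * L := by
    have := Real.log_le_log two_pos hT2
    linarith [Real.log_two_gt_d9]
  set s := √((T : ℝ) * β) with hs
  set ε := 1 - γ with hε
  have hεη : ε = η * √((β : ℝ) / T) := by rw [hε, hγη]; ring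
  have hε0 : 0 < ε := by rw [hεη]; positivity
  have hγ1 : γ < 1 := by linarith
  have hεT : ε * T = η * s := by
    have : √((β : ℝ) / T) * T = s := by
      have e : (T : ℝ) * β = β / T * T ^ 2 := by field_simp
      rw [hs, e, Real.sqrt_mul (by positivity), Real.sqrt_sq hT0.le]
    rw [hεη, mul_assoc, this]
  have hs2 : s ^ 2 = T * β := Real.sq_sqrt (by positivity)
  have hs0 : 0 ≤ s := Real.sqrt_nonneg _
  have hβs : (β : ℝ) ≤ s := Real.le_sqrt_of_sq_le (by nlinarith)
  have hs1 : 1 ≤ s := by linarith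
  have hβε : β / ε = s / η := by
    rw [div_eq_div_iff hε0.ne' hη.ne']
    have : T * (β * η) = T * (s * ε) := by
      calc T * (β * η) = s ^ 2 * η := by rw [hs2]; ring
        _ = s * (ε * T) := by rw [hεT]; ring
        _ = T * (s * ε) := by ring
    exact mul_left_cancel₀ hT0.ne' this
  have hy : s ≤ 2 * (s * L) := by nlinarith
  have hy0 : 0 ≤ s * L := by nlinarith
  have hη' := discountGap_pos K l
  have hcL := logConst_pos η
  have hκ := gapConst_nonneg K ξ l Δ
  rw [mul_assoc]
  -- If ε is not small, then T = ηs/ε is itself O(s), and the trivial bound by T suffices.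
  rcases lt_or_ge (discountGap K l) ε with hbig | hsmall
  · have h1 : ∫ ω, suboptimalPulls T P X A a ω ∂P ≤ T := by
      have : ∫ ω, suboptimalPulls T P X A a ω ∂P ≤ ∫ _, (T : ℝ) ∂P := by
        refine integral_mono_of_nonneg (Filter.Eventually.of_forall fun ω =>
          Finset.sum_nonneg fun t _ => ?_) (integrable_const _)
          (Filter.Eventually.of_forall fun ω => ?_)
        · split_ifs <;> norm_num
        · have : suboptimalPulls T P X A a ω ≤ ∑ t ∈ Finset.Icc 1 T, (1 : ℝ) :=
            Finset.sum_le_sum fun t _ => by split_ifs <;> norm_num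
          simpa using this
      simpa using this
    have h2 : (T : ℝ) ≤ η / discountGap K l * s := by
      rw [div_mul_eq_mul_div, le_div_iff₀ hη', ← hεT, mul_comm]
      gcongr
    have h3 : 2 * (η / discountGap K l) * (s * L) ≤ pullConst K ξ l Δ η * (s * L) := by
      refine mul_le_mul_of_nonneg_right ?_ hy0
      unfold pullConst
      have : 0 ≤ 2 * (K : ℝ) + (4 * logConst η / η + 4)
          + (gapConst K ξ l Δ * logConst η + 2) * (1 + η) + 4 * η * (logConst η + 2) := by
        positivity
      linarith
    have h4 := mul_le_mul_of_nonneg_left hy (show 0 ≤ η / discountGap K l by positivity)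
    linarith
  · set Λ := Real.log (1 / ε) with hΛ
    have hW0 := windowLength_pos K l
    have hW : 1 / 2 ≤ γ ^ windowLength K l := by
      have h1 := one_add_mul_le_pow (a := -ε) (by linarith) (windowLength K l)
      rw [show 1 + -ε = γ by linarith] at h1
      have h2 : ε * (2 * windowLength K l) ≤ 1 := by
        rw [← le_div_iff₀ (by positivity)]
        exact hsmall.trans (min_le_left _ _)
      linarith
    have he7 : ε ≤ Real.exp (-7) := hsmall.trans (min_le_right _ _)
    have hΛ7 : 7 ≤ Λ := by
      rw [hΛ, one_div, Real.log_inv]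
      have := Real.log_le_log hε0 he7
      rw [Real.log_exp] at this
      linarith
    have hε4 : ε ≤ 1 / 4 := by
      refine he7.trans ?_
      rw [Real.exp_neg]
      refine inv_le_of_inv_le₀ (by norm_num) ?_
      linarith [Real.add_one_le_exp (7 : ℝ)]
    have hΛL : Λ ≤ logConst η * L := by
      -- Equivalent to s ≥ 1; the additive |log η| left after taking logarithms is absorbed through
      -- 1 ≤ 2 log T, valid because T ≥ 2.
      have h1 : 1 / ε ≤ T / η := by
        rw [div_le_div_iff₀ hε0 hη, one_mul, mul_comm, hεT]
        exact le_mul_of_one_le_right hη.le hs1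
      have h2 := Real.log_le_log (by positivity) h1
      rw [Real.log_div hT0.ne' hη.ne'] at h2
      have h3 := neg_abs_le (Real.log η)
      have h4 := mul_le_mul_of_nonneg_left hL (abs_nonneg (Real.log η))
      unfold logConst
      linarith
    have hmain := integral_suboptimalPulls_le hX hf hA h hγ hγ1 hξ hW hΛ7 hε4 hΔ hgap
    rw [← hβ, ← hε, ← hΛ] at hmain
    have hD : (memoryLength γ : ℝ) ≤ 2 * Λ / ε + 1 :=
      (Nat.ceil_lt_add_one (by positivity)).le
    have hD0 : (0 : ℝ) ≤ memoryLength γ := Nat.cast_nonneg _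
    have hΛs : Λ * s ≤ logConst η * (s * L) := by
      have := mul_le_mul_of_nonneg_right hΛL hs0
      linarith
    have t1 : (K : ℝ) ≤ 2 * K * (s * L) := by
      have := mul_le_mul_of_nonneg_left (hs1.trans hy) (Nat.cast_nonneg (α := ℝ) K)
      linarith
    have t2 : (β : ℝ) * memoryLength γ ≤ (2 * logConst η / η + 2) * (s * L) := by
      have e1 := mul_le_mul_of_nonneg_left hD (show (0 : ℝ) ≤ β by linarith)
      have e2 : (β : ℝ) * (2 * Λ / ε + 1) = 2 / η * (Λ * s) + β := by
        have : (β : ℝ) * (2 * Λ / ε + 1) = 2 * Λ * (β / ε) + β := by ring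
        rw [this, hβε]; ring
      have e3 := mul_le_mul_of_nonneg_left hΛs (show 0 ≤ 2 / η by positivity)
      have e4 : 2 / η * (logConst η * (s * L)) = 2 * logConst η / η * (s * L) := by ring
      linarith
    have t3 : (memoryLength γ : ℝ) ≤ β * memoryLength γ :=
      le_mul_of_one_le_left hD0 hβ1'
    have t4 : (gapConst K ξ l Δ * Λ + 1) * (1 + ε * T)
        ≤ (gapConst K ξ l Δ * logConst η + 2) * (1 + η) * (s * L) := by
      rw [hεT]
      have e1 : (gapConst K ξ l Δ * Λ + 1) * (1 + η * s)
          ≤ (gapConst K ξ l Δ * Λ + 1) * ((1 + η) * s) := by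
        refine mul_le_mul_of_nonneg_left (by linarith) (by positivity)
      have e2 := mul_le_mul_of_nonneg_left hΛs hκ
      have e3 : gapConst K ξ l Δ * (Λ * s) + s
          ≤ (gapConst K ξ l Δ * logConst η + 2) * (s * L) := by linarith
      have e4 := mul_le_mul_of_nonneg_right e3 (show 0 ≤ 1 + η by linarith)
      linarith
    have t5 : 4 * (Λ + 1) * ε * T ≤ 4 * η * (logConst η + 2) * (s * L) := by
      have e1 : 4 * (Λ + 1) * ε * T = 4 * η * (Λ * s + s) := by
        rw [mul_assoc, hεT]; ring
      have e2 : Λ * s + s ≤ (logConst η + 2) * (s * L) := by linarith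
      rw [e1]
      have := mul_le_mul_of_nonneg_left e2 (show 0 ≤ 4 * η by positivity)
      linarith
    have t6 : 0 ≤ 2 * (η / discountGap K l) * (s * L) := by positivity
    have e : 4 * logConst η / η = 2 * (2 * logConst η / η) := by ring
    unfold pullConst
    rw [e]
    linarith

end

end IncentivizedBandit

theorem theorem1 (K : ℕ) (ξ : ℝ) (hξ : 1 / 2 < ξ) (l : NNReal) (Δ : ℝ) (hΔ : 0 < Δ)
    (η : ℝ) (hη : 0 < η) :
    ∃ C : ℝ, 0 < C ∧
      ∀ (Ω : Type*) [mΩ : MeasurableSpace Ω] (P : Measure Ω) [IsProbabilityMeasure P]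
        (ℱ : Filtration ℕ mΩ) (T β : ℕ) (γ : ℝ) (f : ℕ → ℝ → ℝ) (X : ℕ → Fin K → Ω → ℝ)
        (A g : ℕ → Ω → Fin K) (χ r : ℕ → Ω → ℝ),
        IncentivizedBandit.IsRewardProcess T P ℱ X →
        IncentivizedBandit.IsDrift T l f →
        β = IncentivizedBandit.numBreakpoints T P X →
        1 ≤ β →
        γ = 1 - η * √((β : ℝ) / T) →
        0 < γ →
        (∀ t < T, Measurable[ℱ t] (A (t + 1))) →
        (∀ ω, IncentivizedBandit.IsIncentivizedDUCB T γ ξ f (fun t a => X t a ω)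
          (fun t => A t ω) (fun t => g t ω) (fun t => χ t ω) (fun t => r t ω)) →
        (∀ a, IncentivizedBandit.GapAtLeast T P X Δ a →
          ∫ ω, IncentivizedBandit.suboptimalPulls T P X A a ω ∂P
            ≤ C * √((T : ℝ) * β) * Real.log T) ∧
        ((∀ a, IncentivizedBandit.GapAtLeast T P X Δ a) →
          ∫ ω, IncentivizedBandit.regret T P X A ω ∂P
            ≤ K * C * √((T : ℝ) * β) * Real.log T) := by
  refine ⟨IncentivizedBandit.pullConst K ξ l Δ η,
    IncentivizedBandit.pullConst_pos K ξ l Δ hη, ?_⟩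
  intro Ω mΩ P _ ℱ T β γ f X A g χ r hX hf hβ hβ1 hγη hγ hA h
  have hpull := fun a (ha : IncentivizedBandit.GapAtLeast T P X Δ a) =>
    IncentivizedBandit.integral_suboptimalPulls_le_pullConst hX hf hA h hξ hη hβ hβ1 hγη hγ hΔ ha
  refine ⟨hpull, fun hall => (IncentivizedBandit.integral_regret_le hX hA).trans ?_⟩
  refine (Finset.sum_le_sum fun a _ => hpull a (hall a)).trans (le_of_eq ?_)
  rw [Finset.sum_const, Finset.card_univ, Fintype.card_fin, nsmul_eq_mul]
  ring
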